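/- Let $n\ge 1$ and let $\mathbf p_n=(p_n(1),\dots,p_n(n))$ be a probability measure on $[n]=\{1,\dots,n\}$ with $p_n(1)\ge p_n(2)\ge\dots\ge p_n(n)>0$. Let $\chi_1,\dots,\chi_n$ be independent uniform random variables on $[0,1]$ and put $$Y^n_t=-t+\sum_{i=1}^n p_n(i)\mathbf 1_{\{\chi_i\le t\}}=\sum_{i=1}^n p_n(i)\big(\mathbf 1_{\{\chi_i\le t\}}-t\big),\qquad 0\le t\le 1 .$$ Let $\rho_n=\inf\{t>0: Y^n_t\wedge Y^n_{t-}=\inf_{0\le s\le 1}Y^n_s\}$ be the first infimum point of $Y^n$, and let $X^n$ be the Vervaat transform of $Y^n$: $X^n_t=Y^n_{\rho_n+t \bmod 1}-Y^n_{\rho_n-}\wedge Y^n_{\rho_n}$ for $0\le t<1$, $X^n_1=X^n_{1-}$, and $X^n_t=0$ for $t\notin[0,1]$. Its jump times are $\chi'_i=\chi_i-\rho_n \bmod 1$, $1\le i\le n$. View $X^n$ as the load of a single-server last-in-first-out queue with customers $1,\dots,n$: customer $i$ arrives at time $\chi'_i$ and stays in the queue until time $\sigma(\chi'_i)$, where $\sigma(s)=\inf\{t>s: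 X^n_t<X^n_{s-}\}\in[s,+\infty]$ is the time at which the load falls back to its level prior to $s$. At each time the server serves the customer who, among all those in the queue, arrived last. The genealogy of the customers is defined as follows: the root is the customer who arrives first, and $j$ is a child of $i$ if and only if the arrival of $j$ interrupts the service of $i$, i.e. $i$ is in service just before time $\chi'_j$. Then, almost surely, each customer $i$ is in service during $[0,1]$ for a total time exactly $p_n(i)$, and this genealogy is a rooted tree $T^{\mathrm{lab}}_n$ with vertex set $[n]$. Moreover, $T^{\mathrm{lab}}_n$ is a $\mathbf p_n$-tree: for every rooted tree $t$ with vertex set $[n]$, $$\mathbb P\big(T^{\mathrm{lab}}_n=t\big)=\pi^{\mathbf p_n}(t)=\prod_{i\in[n]}p_n(i)^{\kappa_i(t)},$$ where $\kappa_i(t)$ is the number of children of the vertex $i$ in $t$. -/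

import Mathlib

open MeasureTheory ProbabilityTheory

namespace PTree

/-! ### Labelled rooted trees and the `p`-tree law -/

/-- A labelled rooted tree with vertex labels `Fin n`: a graph-theoretic tree on the vertex set
`Fin n` with a distinguished vertex, the root. -/
structure LabelledRootedTree (n : ℕ) where
  /-- the underlying graph -/
  graph : SimpleGraph (Fin n)
  /-- the underlying graph is a tree -/
  isTree : graph.IsTree
  /-- the root -/
  root : Fin n

namespace LabelledRootedTree

variable {n : ℕ}

/-- The family relation of a rooted tree: `j` is a child of `i` if `j` is a neighbour of `i` that
is one generation further away from the root. -/
def IsChild (t : LabelledRootedTree n) (i j : Fin n) : Prop :=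
  t.graph.Adj i j ∧ t.graph.dist t.root j = t.graph.dist t.root i + 1

/-- The number of children of the vertex `i`. -/
noncomputable def numChildren (t : LabelledRootedTree n) (i : Fin n) : ℕ :=
  {j | t.IsChild i j}.ncard

/-- Every vertex other than the root is the child of some vertex. -/
theorem exists_isChild (t : LabelledRootedTree n) {j : Fin n} (hj : j ≠ t.root) :
    ∃ i, t.IsChild i j := by
  obtain ⟨w, hw⟩ := t.isTree.connected.exists_walk_length_eq_dist j t.root
  cases w with
  | nil => exact absurd rfl hj
  | @cons _ v _ h q =>
    refine ⟨v, h.symm, ?_⟩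
    have h1 : t.graph.dist v t.root ≤ q.length := SimpleGraph.dist_le q
    have h2 : t.graph.dist t.root j ≤ t.graph.dist t.root v + t.graph.dist v j :=
      t.isTree.connected.dist_triangle
    have h3 : t.graph.dist v j = 1 := SimpleGraph.dist_eq_one_iff_adj.2 h.symm
    rw [SimpleGraph.Walk.length_cons, SimpleGraph.dist_comm] at hw
    rw [SimpleGraph.dist_comm] at h1
    omega

/-- Two adjacent vertices are in a parent-child relation. -/
theorem adj_iff (t : LabelledRootedTree n) (i j : Fin n) :
    t.graph.Adj i j ↔ t.IsChild i j ∨ t.IsChild j i := by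
  constructor
  · intro h
    have h0 := t.isTree.dist_ne_of_adj t.root h
    have h1 : t.graph.dist t.root j ≤ t.graph.dist t.root i + t.graph.dist i j :=
      t.isTree.connected.dist_triangle
    have h2 : t.graph.dist t.root i ≤ t.graph.dist t.root j + t.graph.dist j i :=
      t.isTree.connected.dist_triangle
    rw [SimpleGraph.dist_eq_one_iff_adj.2 h] at h1
    rw [SimpleGraph.dist_eq_one_iff_adj.2 h.symm] at h2
    rcases lt_or_gt_of_ne h0 with h3 | h3
    · exact Or.inl ⟨h, by omega⟩
    · exact Or.inr ⟨h.symm, by omega⟩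
  · rintro (h | h)
    · exact h.1
    · exact h.1.symm

/-- A labelled rooted tree is determined by its family relation. -/
theorem ext_isChild {t t' : LabelledRootedTree n}
    (h : ∀ i j, t.IsChild i j ↔ t'.IsChild i j) : t = t' := by
  have hg : t.graph = t'.graph := by
    ext i j
    rw [adj_iff, adj_iff, h, h]
  have hr : t.root = t'.root := by
    by_contra hne
    obtain ⟨i, hi⟩ := t'.exists_isChild hne
    have h1 := ((h _ _).2 hi).2
    simp at h1
  cases t
  cases t'
  simp_all

end LabelledRootedTree

/-- The set of labelled rooted trees is finite; all its subsets are measurable. -/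
instance (n : ℕ) : MeasurableSpace (LabelledRootedTree n) := ⊤

/-- All subsets are measurable. -/
instance (n : ℕ) : MeasurableSpace (Option (LabelledRootedTree n)) := ⊤

/-- The law `π^p` of a `p`-tree, which gives the tree `t` the mass `∏ i, p i ^ κ i (t)`. -/
noncomputable def pTreeLaw {n : ℕ} (p : Fin n → ℝ) : Measure (LabelledRootedTree n) :=
  Measure.sum fun t : LabelledRootedTree n =>
    ENNReal.ofReal (∏ i, p i ^ t.numChildren i) • Measure.dirac t

/-! ### The bridge and its Vervaat transform -/

open Classical in
/-- The bridge `Y t = -t + ∑ i, p i * 1_{χ i ≤ t}`, `0 ≤ t ≤ 1`. -/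
noncomputable def bridge {n : ℕ} (p χ : Fin n → ℝ) (t : ℝ) : ℝ :=
  -t + ∑ i, p i * (if χ i ≤ t then 1 else 0)

/-- The first infimum point `inf {t > 0 : y(t) ∧ y(t-) = inf_{[0,1]} y}` of a path `y` on
`[0, 1]`. -/
noncomputable def infPoint (y : ℝ → ℝ) : ℝ :=
  sInf {t | 0 < t ∧ t ≤ 1 ∧ min (y t) (Function.leftLim y t) = sInf (y '' Set.Icc 0 1)}

/-- The path `t ↦ y(ρ + t mod 1) - y(ρ-) ∧ y(ρ)`, where `ρ` is the first infimum point of `y`. -/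
noncomputable def vervaatShift (y : ℝ → ℝ) (t : ℝ) : ℝ :=
  y (Int.fract (infPoint y + t)) - min (Function.leftLim y (infPoint y)) (y (infPoint y))

open Classical in
/-- The Vervaat transform `x` of a path `y` on `[0, 1]`: the path `vervaatShift y` on `[0, 1)`,
with `x(1) = x(1-)`, and extended by `0` outside `[0, 1]` (so that `x(0-) = 0`). -/
noncomputable def vervaat (y : ℝ → ℝ) (t : ℝ) : ℝ :=
  if t < 0 then 0
  else if t < 1 then vervaatShift y t
  else if t = 1 then Function.leftLim (vervaatShift y) 1
  else 0

/-- The jump times `χ' i = χ i - ρ mod 1` of the Vervaat transform of the bridge, where `ρ` is the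
first infimum point of the bridge. -/
noncomputable def arrival {n : ℕ} (p χ : Fin n → ℝ) (i : Fin n) : ℝ :=
  Int.fract (χ i - infPoint (bridge p χ))

/-! ### The last-in-first-out queue

The path `x` is the load of the server (the amount of unfulfilled service time of the customers in
the queue), and customer `i` arrives at time `a i`. -/

/-- `σ_x(s) = inf {t > s : x(t) < x(s-)} ∈ [s, +∞]`, the first moment when the load falls back to
the level prior to time `s`. -/
noncomputable def departure (x : ℝ → ℝ) (s : ℝ) : EReal :=
  sInf ((fun t : ℝ => (t : EReal)) '' {t | s < t ∧ x t < Function.leftLim x s})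

/-- Customer `i` is in the queue just before time `t`: he arrived before time `t` and leaves, at
time `σ_x(a i)`, after time `t`. -/
def InQueue {n : ℕ} (x : ℝ → ℝ) (a : Fin n → ℝ) (i : Fin n) (t : ℝ) : Prop :=
  a i < t ∧ (t : EReal) < departure x (a i)

/-- The last-in-first-out rule: just before time `t` the server serves customer `i` if `i` is, of
all the customers in the queue, the last to have arrived. -/
def InService {n : ℕ} (x : ℝ → ℝ) (a : Fin n → ℝ) (i : Fin n) (t : ℝ) : Prop :=
  InQueue x a i t ∧ ∀ k, InQueue x a k t → a k ≤ a i

/-- `t` is the labelled rooted tree of the last-in-first-out queue: its root is the customer who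
arrives first, and customer `j` is a child of customer `i` if and only if the arrival of `j`
interrupts the service of `i`. -/
def IsLIFOTree {n : ℕ} (x : ℝ → ℝ) (a : Fin n → ℝ) (t : LabelledRootedTree n) : Prop :=
  (∀ j, a t.root ≤ a j) ∧ ∀ i j, t.IsChild i j ↔ InService x a i (a j)

/-- There is at most one tree with the genealogy of the queue. -/
theorem IsLIFOTree.unique {n : ℕ} {x : ℝ → ℝ} {a : Fin n → ℝ} {t t' : LabelledRootedTree n}
    (h : IsLIFOTree x a t) (h' : IsLIFOTree x a t') : t = t' :=
  LabelledRootedTree.ext_isChild fun i j => (h.2 i j).trans (h'.2 i j).symm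

open Classical in
/-- The labelled rooted tree of the last-in-first-out queue, and `none` if the genealogy of the
customers is not a rooted tree. -/
noncomputable def lifoTree {n : ℕ} (x : ℝ → ℝ) (a : Fin n → ℝ) : Option (LabelledRootedTree n) :=
  if h : ∃ t, IsLIFOTree x a t then some h.choose else none

end PTree

/-! Fix a tree `t`. Let `y t.root` range over `(0, 1)` and, for each child `j` of `i`, let `y j`
range over `(0, p i)`: it is the amount of service that `i` has received when `j` interrupts it.
These data determine all arrival times. Customer `i` and its descendants occupy an interval of
length `t.mass p i`, so `j` arrives `y j` plus the masses of the siblings that interrupted earlier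
after `i` does. With the root placed at `y t.root` and everything reduced modulo 1, this gives the
jump times `t.jumpTimes p y`. For generic `y` the Vervaat transform undoes the rotation, and the
queue returns `t` (`Admissible.lifoTree_eq`), each customer being served for its mass minus the
masses of its children, that is, `p i`.

While the order of siblings and the integer parts stay fixed, the arrival of `j` is the sum of `y`
over the ancestors of `j`, plus a constant. The derivative is thus unipotent and the map, which is
injective, preserves volume. Its image has the volume of the box of the `y`, namely the product of
`p (parent of j)` over `j ≠ root`, which is the `p`-tree weight of `t` (`volume_jumpTimes_image`).

The images fill the cube up to a null set (`exists_admissible_jumpTimes_eq`). If no difference of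
jump times lies in the countable group generated by `1` and the `p i`, the levels just before the
arrivals are distinct; the parent of `j` is then the last earlier customer with a lower level, and
`y j` is read off the difference of the two levels. The law of the tree is therefore the list of
these volumes. -/

namespace PTree

/-! ### Ancestry, subtree masses, and trees built from parent functions. -/

namespace LabelledRootedTree

variable {n : ℕ}

/-- Parents are unique. -/
theorem IsChild.unique {t : LabelledRootedTree n} {i i' j : Fin n} (h : t.IsChild i j)
    (h' : t.IsChild i' j) : i = i' := by
  obtain ⟨w, hw⟩ := t.isTree.connected.exists_walk_length_eq_dist t.root i
  obtain ⟨w', hw'⟩ := t.isTree.connected.exists_walk_length_eq_dist t.root i'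
  have e1 : (w.concat h.1).IsPath := by
    apply SimpleGraph.Walk.isPath_of_length_eq_dist
    rw [SimpleGraph.Walk.length_concat, hw, h.2]
  have e2 : (w'.concat h'.1).IsPath := by
    apply SimpleGraph.Walk.isPath_of_length_eq_dist
    rw [SimpleGraph.Walk.length_concat, hw', h'.2]
  have e3 : w.concat h.1 = w'.concat h'.1 :=
    (t.isTree.existsUnique_path _ _).unique e1 e2
  obtain ⟨hi, -⟩ := SimpleGraph.Walk.concat_inj e3
  exact hi

theorem not_isChild_root (t : LabelledRootedTree n) (i : Fin n) : ¬ t.IsChild i t.root := by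
  intro h
  have := h.2
  simp at this

theorem IsChild.ne_root {t : LabelledRootedTree n} {i j : Fin n} (h : t.IsChild i j) :
    j ≠ t.root := by
  rintro rfl
  exact t.not_isChild_root i h

/-- `t.Anc i j` means that `i` is an ancestor of `j`, or `j` itself. -/
def Anc (t : LabelledRootedTree n) : Fin n → Fin n → Prop :=
  Relation.ReflTransGen t.IsChild

theorem Anc.refl (t : LabelledRootedTree n) (i : Fin n) : t.Anc i i :=
  Relation.ReflTransGen.refl

theorem Anc.trans {t : LabelledRootedTree n} {i j k : Fin n} (h : t.Anc i j) (h' : t.Anc j k) :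
    t.Anc i k :=
  Relation.ReflTransGen.trans h h'

theorem IsChild.anc {t : LabelledRootedTree n} {i j : Fin n} (h : t.IsChild i j) : t.Anc i j :=
  Relation.ReflTransGen.single h

theorem Anc.dist_le {t : LabelledRootedTree n} {i j : Fin n} (h : t.Anc i j) :
    t.graph.dist t.root i ≤ t.graph.dist t.root j := by
  induction h with
  | refl => exact le_rfl
  | tail _ h ih =>
    have := h.2
    omega

theorem Anc.dist_lt {t : LabelledRootedTree n} {i j : Fin n} (h : t.Anc i j) (hij : i ≠ j) :
    t.graph.dist t.root i < t.graph.dist t.root j := by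
  rcases Relation.ReflTransGen.cases_head h with rfl | ⟨k, hk, hkj⟩
  · exact absurd rfl hij
  · have := Anc.dist_le hkj
    have := hk.2
    omega

theorem Anc.antisymm {t : LabelledRootedTree n} {i j : Fin n} (h : t.Anc i j) (h' : t.Anc j i) :
    i = j := by
  by_contra hij
  have := h.dist_lt hij
  have := h'.dist_le
  omega

theorem Anc.eq_or_exists_isChild {t : LabelledRootedTree n} {i j : Fin n} (h : t.Anc i j) :
    i = j ∨ ∃ k, t.IsChild i k ∧ t.Anc k j :=
  Relation.ReflTransGen.cases_head h

theorem IsChild.anc_iff {t : LabelledRootedTree n} {i j k : Fin n} (h : t.IsChild i j) :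
    t.Anc k j ↔ k = j ∨ t.Anc k i := by
  constructor
  · intro hk
    rcases Relation.ReflTransGen.cases_tail hk with rfl | ⟨i', hki', hi'⟩
    · exact Or.inl rfl
    · rw [h.unique hi']
      exact Or.inr hki'
  · rintro (rfl | hk)
    · exact Anc.refl t _
    · exact hk.trans h.anc

theorem anc_root_iff {t : LabelledRootedTree n} {k : Fin n} : t.Anc k t.root ↔ k = t.root := by
  constructor
  · intro hk
    rcases Relation.ReflTransGen.cases_tail hk with h | ⟨i, -, hi⟩
    · exact h.symm
    · exact absurd hi (t.not_isChild_root i)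
  · rintro rfl
    exact Anc.refl t _

/-- Induction from the root of a tree towards its leaves. -/
theorem induction_on {t : LabelledRootedTree n} {motive : Fin n → Prop} (j : Fin n)
    (root : motive t.root) (child : ∀ i j, t.IsChild i j → motive i → motive j) : motive j := by
  induction hd : t.graph.dist t.root j generalizing j with
  | zero =>
    rw [← (t.isTree.connected.dist_eq_zero_iff).1 hd]
    exact root
  | succ d ih =>
    have hj : j ≠ t.root := by
      rintro rfl
      simp at hd
    obtain ⟨i, hi⟩ := t.exists_isChild hj
    refine child i j hi (ih i ?_)
    have := hi.2
    omega

theorem anc_root (t : LabelledRootedTree n) (j : Fin n) : t.Anc t.root j :=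
  induction_on j (Anc.refl t _) fun _ _ h ih => ih.trans h.anc

/-- Since parents are unique, the ancestors of `l` form a chain, and two vertices of the same depth
in a chain coincide. Hence the subtrees of distinct siblings are disjoint. -/
theorem IsChild.eq_of_anc {t : LabelledRootedTree n} {i k k' l : Fin n} (h : t.IsChild i k)
    (h' : t.IsChild i k') (hl : t.Anc k l) (hl' : t.Anc k' l) : k = k' := by
  have key : ∀ {a b : Fin n}, t.IsChild i a → t.IsChild i b → t.Anc a b → a = b := by
    intro a b ha hb hab
    by_contra hne
    have := hab.dist_lt hne
    have := ha.2
    have := hb.2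
    omega
  have hU : Relator.RightUnique (Function.swap t.IsChild) := fun a b c h1 h2 =>
    IsChild.unique h1 h2
  rcases Relation.ReflTransGen.total_of_right_unique hU (Relation.reflTransGen_swap.2 hl)
    (Relation.reflTransGen_swap.2 hl') with h3 | h3
  · exact (key h' h (Relation.reflTransGen_swap.1 h3)).symm
  · exact key h h' (Relation.reflTransGen_swap.1 h3)

open scoped Classical in
/-- The total mass of the descendants of `i`, including `i`. -/
noncomputable def mass (t : LabelledRootedTree n) (p : Fin n → ℝ) (i : Fin n) : ℝ :=
  ∑ j with t.Anc i j, p j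

open scoped Classical in
theorem sum_mass_eq {t : LabelledRootedTree n} (p : Fin n → ℝ) {i : Fin n} (s : Finset (Fin n))
    (hs : ∀ k ∈ s, t.IsChild i k) :
    ∑ k ∈ s, t.mass p k = ∑ l with ∃ k ∈ s, t.Anc k l, p l := by
  have : (Finset.univ.filter fun l => ∃ k ∈ s, t.Anc k l)
      = s.biUnion fun k => Finset.univ.filter fun l => t.Anc k l := by
    ext l
    simp
  rw [this, Finset.sum_biUnion]
  · rfl
  · intro k hk k' hk' hne
    rw [Function.onFun, Finset.disjoint_left]
    intro l hl hl'
    simp only [Finset.mem_filter, Finset.mem_univ, true_and] at hl hl'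
    exact hne ((hs k hk).eq_of_anc (hs k' hk') hl hl')

open scoped Classical in
theorem mass_eq (t : LabelledRootedTree n) (p : Fin n → ℝ) (i : Fin n) :
    t.mass p i = p i + ∑ k with t.IsChild i k, t.mass p k := by
  rw [sum_mass_eq p _ (i := i) (by simp)]
  have : (Finset.univ.filter fun l => t.Anc i l) = insert i
      (Finset.univ.filter fun l => ∃ k ∈ Finset.univ.filter (fun k => t.IsChild i k),
        t.Anc k l) := by
    ext l
    simp only [Finset.mem_filter, Finset.mem_univ, true_and, Finset.mem_insert]
    constructor
    · intro h
      rcases h.eq_or_exists_isChild with h | h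
      · exact Or.inl h.symm
      · exact Or.inr h
    · rintro (rfl | ⟨k, hk, hkl⟩)
      · exact Anc.refl t _
      · exact hk.anc.trans hkl
  rw [mass, this, Finset.sum_insert]
  simp only [Finset.mem_filter, Finset.mem_univ, true_and, not_exists, not_and]
  intro k hk hki
  have := hki.dist_le
  have := hk.2
  omega

theorem mass_root (t : LabelledRootedTree n) (p : Fin n → ℝ) : t.mass p t.root = ∑ i, p i := by
  simp [mass, anc_root]

theorem mass_pos (t : LabelledRootedTree n) {p : Fin n → ℝ} (hp : ∀ i, 0 < p i) (i : Fin n) :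
    0 < t.mass p i := by
  classical
  exact Finset.sum_pos (fun j _ => hp j) ⟨i, by simp [Anc.refl]⟩

/-- A parent function along which some rank strictly increases is the family relation of a
labelled rooted tree. -/
theorem exists_of_parent {r : Fin n} {par : Fin n → Fin n} {b : Fin n → ℝ}
    (hb : ∀ j, j ≠ r → b (par j) < b j) :
    ∃ t : LabelledRootedTree n, t.root = r ∧ ∀ i j, t.IsChild i j ↔ j ≠ r ∧ par j = i := by
  classical
  let G : SimpleGraph (Fin n) :=
    { Adj := fun i j => (j ≠ r ∧ par j = i) ∨ (i ≠ r ∧ par i = j)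
      symm := ⟨fun i j h => h.symm⟩
      loopless := ⟨fun i h => by
        have h' : i ≠ r ∧ par i = i := by tauto
        have := hb i h'.1
        rw [h'.2] at this
        exact lt_irrefl _ this⟩ }
  have ind : ∀ (C : Fin n → Prop), C r → (∀ j, j ≠ r → C (par j) → C j) → ∀ j, C j := by
    intro C h0 h1 j
    by_contra hj
    obtain ⟨k, hk, hmin⟩ := Finset.exists_min_image (Finset.univ.filter fun j => ¬ C j) b
      ⟨j, by simpa using hj⟩
    simp only [Finset.mem_filter, Finset.mem_univ, true_and] at hk hmin
    have hkr : k ≠ r := by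
      rintro rfl
      exact hk h0
    refine hk (h1 k hkr ?_)
    by_contra hc
    exact absurd (hmin _ hc) (not_le.2 (hb k hkr))
  have hreach : ∀ j, G.Reachable r j := ind _ (SimpleGraph.Reachable.refl _) fun j hj h =>
    h.trans (SimpleGraph.Adj.reachable (Or.inl ⟨hj, rfl⟩))
  have hconn : G.Connected := by
    have : Nonempty (Fin n) := ⟨r⟩
    exact ⟨fun i j => (hreach i).symm.trans (hreach j)⟩
  have hdepth : ∃ d : Fin n → ℕ, d r = 0 ∧ ∀ j, j ≠ r → d j = d (par j) + 1 := by
    have hit : ∀ j, ∃ k, par^[k] j = r := ind _ ⟨0, rfl⟩ fun j _ ⟨k, hk⟩ => ⟨k + 1, hk⟩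
    refine ⟨fun j => Nat.find (hit j), ?_, ?_⟩
    · exact (Nat.find_eq_zero (hit r)).2 rfl
    · intro j hj
      exact Nat.find_comp_succ (hit j) (hit (par j)) hj
  obtain ⟨d, hd0, hd⟩ := hdepth
  -- The depth rises by at most one along an edge, so no walk from `r` to `j` is shorter than `d j`;
  -- following parents gives the converse bound, and `d` is the graph distance.
  have hadj : ∀ i j, G.Adj i j → d j ≤ d i + 1 := by
    rintro i j (⟨h1, rfl⟩ | ⟨h1, rfl⟩)
    · exact (hd j h1).le
    · have := hd i h1
      omega
  have hwalk : ∀ (i j : Fin n) (w : G.Walk i j), d j ≤ d i + w.length := by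
    intro i j w
    induction w with
    | nil => simp
    | cons h w ih =>
      have := hadj _ _ h
      rw [SimpleGraph.Walk.length_cons]
      omega
  have hdist : ∀ j, G.dist r j = d j := by
    intro j
    apply le_antisymm
    · refine ind (fun j => G.dist r j ≤ d j) (by simp) (fun j hj h => ?_) j
      have h1 : G.dist r j ≤ G.dist r (par j) + G.dist (par j) j := hconn.dist_triangle
      have h2 : G.dist (par j) j = 1 := SimpleGraph.dist_eq_one_iff_adj.2 (Or.inl ⟨hj, rfl⟩)
      have h3 := hd j hj
      omega
    · obtain ⟨w, hw⟩ := hconn.exists_walk_length_eq_dist r j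
      have := hwalk _ _ w
      omega
  -- Every edge joins some `j ≠ r` to its parent, so there are at most `n - 1` edges; connectedness
  -- gives the reverse inequality.
  have hcard : Nat.card G.edgeSet + 1 = Nat.card (Fin n) := by
    apply le_antisymm
    · have hsub : G.edgeSet ⊆ ((Finset.univ.erase r).image fun j => s(par j, j) : Finset _) := by
        intro e
        induction e with | _ i j => ?_
        rw [SimpleGraph.mem_edgeSet]
        rintro (⟨h1, rfl⟩ | ⟨h1, rfl⟩)
        · simp only [Finset.coe_image, Set.mem_image]
          exact ⟨j, by simpa using h1, rfl⟩
        · simp only [Finset.coe_image, Set.mem_image]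
          exact ⟨i, by simpa using h1, Sym2.eq_swap⟩
      have h1 := Set.ncard_le_ncard hsub (Finset.finite_toSet _)
      rw [Set.ncard_coe_finset] at h1
      have h2 := h1.trans Finset.card_image_le
      rw [Finset.card_erase_of_mem (Finset.mem_univ r), Finset.card_univ, Fintype.card_fin] at h2
      rw [Nat.card_coe_set_eq, Nat.card_eq_fintype_card, Fintype.card_fin]
      have := r.pos
      omega
    · exact hconn.card_vert_le_card_edgeSet_add_one
  refine ⟨⟨G, SimpleGraph.isTree_iff_connected_and_card.2 ⟨hconn, hcard⟩, r⟩, rfl, ?_⟩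
  intro i j
  change G.Adj i j ∧ G.dist r j = G.dist r i + 1 ↔ _
  rw [hdist, hdist]
  constructor
  · rintro ⟨h | ⟨h1, rfl⟩, h2⟩
    · exact h
    · have := hd i h1
      omega
  · rintro ⟨h1, rfl⟩
    exact ⟨Or.inl ⟨h1, rfl⟩, hd j h1⟩

open scoped Classical in
/-- The sum of `p` over the children, as counted by `numChildren`. -/
theorem prod_pow_numChildren (t : LabelledRootedTree n) (p q : Fin n → ℝ) (hr : q t.root = 1)
    (hq : ∀ i j, t.IsChild i j → q j = p i) : ∏ j, q j = ∏ i, p i ^ t.numChildren i := by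
  have h1 : ∀ i, p i ^ t.numChildren i = ∏ j with t.IsChild i j, q j := by
    intro i
    rw [Finset.prod_congr rfl (g := fun _ => p i), Finset.prod_const, numChildren,
      Set.ncard_eq_toFinset_card', Set.toFinset_ofPred]
    intro j hj
    exact hq i j (by simpa using hj)
  have h2 : (Finset.univ.erase t.root) =
      Finset.univ.biUnion fun i => Finset.univ.filter fun j => t.IsChild i j := by
    ext j
    simp only [Finset.mem_erase, Finset.mem_univ, and_true, Finset.mem_biUnion, Finset.mem_filter,
      true_and]
    exact ⟨fun h => t.exists_isChild h, fun ⟨i, hi⟩ => hi.ne_root⟩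
  rw [← Finset.mul_prod_erase _ _ (Finset.mem_univ t.root), hr, one_mul, h2, Finset.prod_biUnion]
  · exact Finset.prod_congr rfl fun i _ => (h1 i).symm
  · intro i _ i' _ hne
    rw [Function.onFun, Finset.disjoint_left]
    intro j hj hj'
    simp only [Finset.mem_filter, Finset.mem_univ, true_and] at hj hj'
    exact hne (hj.unique hj')

instance : Finite (LabelledRootedTree n) := by
  refine Finite.of_injective (fun t : LabelledRootedTree n => (t.graph, t.root)) ?_
  rintro ⟨G, hG, r⟩ ⟨G', hG', r'⟩ h
  simp only [Prod.mk.injEq] at h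
  obtain ⟨rfl, rfl⟩ := h
  rfl

end LabelledRootedTree

end PTree

/-! ### From service requirements to arrival times. -/

namespace PTree

/-- The left-continuous version `-s + ∑ i, p i * 1_{χ i < s}` of the bridge. -/
noncomputable def leftBridge {n : ℕ} (p χ : Fin n → ℝ) (s : ℝ) : ℝ :=
  -s + ∑ i, p i * (if χ i < s then 1 else 0)

namespace LabelledRootedTree

variable {n : ℕ} {t : LabelledRootedTree n} {p y : Fin n → ℝ}

open scoped Classical in
/-- The arrival times (up to a translation) of the customers of a last-in-first-out queue with
genealogy `t`, when the arrival of `j` interrupts the service of its parent after `y j` units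
of service. -/
noncomputable def position (t : LabelledRootedTree n) (p y : Fin n → ℝ) (j : Fin n) : ℝ :=
  ∑ k with t.Anc k j,
    (y k + ∑ l with (∃ i, t.IsChild i l ∧ t.IsChild i k) ∧ y l < y k, t.mass p l)

theorem position_root (t : LabelledRootedTree n) (p y : Fin n → ℝ) :
    t.position p y t.root = y t.root := by
  classical
  rw [position]
  simp only [anc_root_iff, Finset.sum_filter, Finset.sum_ite_eq', Finset.mem_univ, if_true]
  simp [not_isChild_root]

open scoped Classical in
theorem IsChild.position_eq {i j : Fin n} (h : t.IsChild i j) (p y : Fin n → ℝ) :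
    t.position p y j = t.position p y i +
      (y j + ∑ l with t.IsChild i l ∧ y l < y j, t.mass p l) := by
  have h1 : (Finset.univ.filter fun k => t.Anc k j) =
      insert j (Finset.univ.filter fun k => t.Anc k i) := by
    ext k
    simp [h.anc_iff]
  have h2 : ∀ l, (∃ i, t.IsChild i l ∧ t.IsChild i j) ↔ t.IsChild i l := fun l =>
    ⟨fun ⟨i', h', h''⟩ => by rwa [h.unique h''], fun h' => ⟨i, h', h⟩⟩
  rw [position, h1, Finset.sum_insert, add_comm]
  · simp only [h2]
    rfl
  · simp only [Finset.mem_filter, Finset.mem_univ, true_and]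
    intro hji
    have := hji.dist_le
    have := h.2
    omega

/-- The service requirements `y` are admissible for the tree `t`. -/
structure Admissible (t : LabelledRootedTree n) (p y : Fin n → ℝ) : Prop where
  root_pos : 0 < y t.root
  root_lt : y t.root < 1
  pos : ∀ i j, t.IsChild i j → 0 < y j
  lt : ∀ i j, t.IsChild i j → y j < p i
  ne : ∀ i j k, t.IsChild i j → t.IsChild i k → j ≠ k → y j ≠ y k
  fract_ne : ∀ j, Int.fract (t.position p y j) ≠ 0

/-- The delay of `k` counts every sibling counted for `j` and also `j` itself, so `j` and its
descendants are finished before `k` arrives. -/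
theorem IsChild.position_add_mass_lt_position (hp : ∀ i, 0 < p i) {i j k : Fin n}
    (h : t.IsChild i j) (h' : t.IsChild i k) (hjk : y j < y k) :
    t.position p y j + t.mass p j < t.position p y k := by
  classical
  have h1 : ∑ l with t.IsChild i l ∧ y l < y j, t.mass p l + t.mass p j ≤
      ∑ l with t.IsChild i l ∧ y l < y k, t.mass p l := by
    rw [add_comm, ← Finset.sum_insert (by simp)]
    refine Finset.sum_le_sum_of_subset_of_nonneg ?_ fun l _ _ => (t.mass_pos hp l).le
    intro l
    simp only [Finset.mem_filter, Finset.mem_univ, true_and, Finset.mem_insert]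
    rintro (rfl | hl)
    · exact ⟨h, hjk⟩
    · exact ⟨hl.1, hl.2.trans hjk⟩
  rw [h.position_eq, h'.position_eq]
  linarith

section position

variable (hp : ∀ i, 0 < p i) (hy : t.Admissible p y)
include hp hy

theorem Admissible.position_lt {i j : Fin n} (h : t.IsChild i j) :
    t.position p y i < t.position p y j := by
  classical
  have h1 := hy.pos i j h
  have h2 : 0 ≤ ∑ l with t.IsChild i l ∧ y l < y j, t.mass p l :=
    Finset.sum_nonneg fun l _ => (t.mass_pos hp l).le
  rw [h.position_eq]
  linarith

theorem Admissible.position_add_mass_lt {i j : Fin n} (h : t.IsChild i j) :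
    t.position p y j + t.mass p j < t.position p y i + t.mass p i := by
  classical
  have h1 : ∑ l with t.IsChild i l ∧ y l < y j, t.mass p l + t.mass p j ≤
      ∑ l with t.IsChild i l, t.mass p l := by
    rw [add_comm, ← Finset.sum_insert (by simp)]
    refine Finset.sum_le_sum_of_subset_of_nonneg ?_ fun l _ _ => (t.mass_pos hp l).le
    intro l
    simp only [Finset.mem_filter, Finset.mem_univ, true_and, Finset.mem_insert]
    rintro (rfl | hl)
    · exact h
    · exact hl.1
  have h2 := hy.lt i j h
  rw [h.position_eq, t.mass_eq p i]
  linarith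

theorem Admissible.position_lt_iff {i j k : Fin n} (h : t.IsChild i j) (h' : t.IsChild i k) :
    t.position p y j < t.position p y k ↔ y j < y k := by
  have key : ∀ {j k}, t.IsChild i j → t.IsChild i k → y j < y k →
      t.position p y j < t.position p y k := fun {j k} h h' hjk => by
    have := h.position_add_mass_lt_position hp h' hjk
    have := t.mass_pos hp j
    linarith
  constructor
  · intro hlt
    by_contra hn
    rcases eq_or_ne j k with rfl | hjk
    · exact lt_irrefl _ hlt
    · have := key h' h (lt_of_le_of_ne (not_lt.1 hn) (hy.ne i j k h h' hjk).symm)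
      exact lt_asymm this hlt
  · exact key h h'

theorem Admissible.position_le_of_anc {i j : Fin n} (h : t.Anc i j) :
    t.position p y i ≤ t.position p y j := by
  induction h with
  | refl => exact le_rfl
  | tail _ h ih => exact ih.trans (hy.position_lt hp h).le

theorem Admissible.position_add_mass_le_of_anc {i j : Fin n} (h : t.Anc i j) :
    t.position p y j + t.mass p j ≤ t.position p y i + t.mass p i := by
  induction h with
  | refl => exact le_rfl
  | tail _ h ih => exact (hy.position_add_mass_lt hp h).le.trans ih

/-- Descend from the root to `i`. When passing from `h` to its child `i`, the customer `l` is
outside the interval of `h`, or is `h` itself, or lies below a sibling of `i`, whose interval is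
disjoint from that of `i`. -/
theorem Admissible.position_of_not_anc {i l : Fin n} (h : ¬ t.Anc i l) :
    t.position p y l < t.position p y i ∨
      t.position p y i + t.mass p i < t.position p y l := by
  revert h
  refine induction_on (t := t) (motive := fun i => ¬ t.Anc i l → t.position p y l <
    t.position p y i ∨ t.position p y i + t.mass p i < t.position p y l) i ?_ ?_
  · intro h
    exact absurd (t.anc_root l) h
  · intro h i hi ih hil
    by_cases hl : t.Anc h l
    · rcases hl.eq_or_exists_isChild with rfl | ⟨k, hk, hkl⟩
      · exact Or.inl (hy.position_lt hp hi)
      · have hki : k ≠ i := by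
          rintro rfl
          exact hil hkl
        have h1 := hy.position_le_of_anc hp hkl
        have h2 := hy.position_add_mass_le_of_anc hp hkl
        have h3 := t.mass_pos hp l
        rcases lt_or_gt_of_ne (hy.ne h k i hk hi hki) with h4 | h4
        · have := hk.position_add_mass_lt_position hp hi h4
          left
          linarith
        · have := hi.position_add_mass_lt_position hp hk h4
          right
          linarith
    · have h1 := hy.position_lt hp hi
      have h2 := hy.position_add_mass_lt hp hi
      rcases ih hl with h3 | h3
      · left
        linarith
      · right
        linarith

theorem Admissible.anc_iff {i l : Fin n} : t.Anc i l ↔ t.position p y i ≤ t.position p y l ∧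
    t.position p y l ≤ t.position p y i + t.mass p i := by
  constructor
  · intro h
    have h1 := hy.position_add_mass_le_of_anc hp h
    have h2 := t.mass_pos hp l
    exact ⟨hy.position_le_of_anc hp h, by linarith⟩
  · rintro ⟨h1, h2⟩
    by_contra h
    rcases hy.position_of_not_anc hp h with h3 | h3 <;> linarith

/-- Between the two arrivals at least `p i` and the masses of the earlier siblings' subtrees are
added, while the elapsed time is `y j` plus those masses. The level thus rises by at least `p i - y
j > 0`. -/
theorem Admissible.leftBridge_lt {i j : Fin n} (h : t.IsChild i j) :
    leftBridge p (t.position p y) (t.position p y i) <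
      leftBridge p (t.position p y) (t.position p y j) := by
  classical
  have h1 : ∑ l with t.IsChild i l ∧ y l < y j, t.mass p l =
    ∑ l with ∃ k ∈ Finset.univ.filter (fun k => t.IsChild i k ∧ y k < y j), t.Anc k l, p l := by
    rw [sum_mass_eq p _ (i := i)]
    intro k hk
    exact (Finset.mem_filter.1 hk).2.1
  have h2 : ∑ k with t.position p y k < t.position p y i, p k +
      (p i + ∑ l with t.IsChild i l ∧ y l < y j, t.mass p l) ≤
      ∑ k with t.position p y k < t.position p y j, p k := by
    rw [h1, ← Finset.sum_insert, ← Finset.sum_union]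
    · refine Finset.sum_le_sum_of_subset_of_nonneg ?_ fun l _ _ => (hp l).le
      intro l
      simp only [Finset.mem_union, Finset.mem_filter, Finset.mem_univ, true_and,
        Finset.mem_insert]
      rintro (hl | rfl | ⟨k, ⟨hk, hkj⟩, hkl⟩)
      · exact hl.trans (hy.position_lt hp h)
      · exact hy.position_lt hp h
      · have h3 := hk.position_add_mass_lt_position hp h hkj
        have h4 := ((hy.anc_iff hp).1 hkl).2
        linarith
    · rw [Finset.disjoint_left]
      intro l
      simp only [Finset.mem_filter, Finset.mem_univ, true_and, Finset.mem_insert]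
      rintro hl (rfl | ⟨k, ⟨hk, -⟩, hkl⟩)
      · exact lt_irrefl _ hl
      · have h3 := hy.position_lt hp hk
        have h4 := hy.position_le_of_anc hp hkl
        linarith
    · simp only [Finset.mem_filter, Finset.mem_univ, true_and, not_exists, not_and, and_imp]
      intro k hk _ hki
      have h3 := hy.position_lt hp hk
      have h4 := hy.position_le_of_anc hp hki
      linarith
  have h3 := h.position_eq p y
  have h4 := hy.lt i j h
  simp only [leftBridge, mul_ite, mul_one, mul_zero, ← Finset.sum_filter]
  linarith

end position

/-- The arrival times `b` of a last-in-first-out queue with genealogy `t`: customer `i` is in the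
queue between times `b i` and `b i + t.mass p i`. -/
structure IsSchedule (t : LabelledRootedTree n) (p b : Fin n → ℝ) : Prop where
  root : b t.root = 0
  anc_iff : ∀ i l, t.Anc i l ↔ b i ≤ b l ∧ b l ≤ b i + t.mass p i
  add_mass_le : ∀ i j, t.Anc i j → b j + t.mass p j ≤ b i + t.mass p i
  leftBridge_lt : ∀ i j, t.IsChild i j → leftBridge p b (b i) < leftBridge p b (b j)

theorem Admissible.isSchedule (hp : ∀ i, 0 < p i) (hy : t.Admissible p y) :
    t.IsSchedule p fun j => t.position p y j - y t.root where
  root := by rw [position_root, sub_self]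
  anc_iff i l := by
    rw [hy.anc_iff hp]
    constructor <;> rintro ⟨h1, h2⟩ <;> constructor <;> linarith
  add_mass_le i j h := by
    have := hy.position_add_mass_le_of_anc hp h
    linarith
  leftBridge_lt i j h := by
    have := hy.leftBridge_lt hp h
    simp only [leftBridge, sub_lt_sub_iff_right] at this ⊢
    linarith

end LabelledRootedTree

end PTree

/-! ### The queue driven by the excursion of a schedule. -/

namespace PTree

section path

variable {n : ℕ}

theorem eventually_nhdsGT_le_iff (χ : Fin n → ℝ) (s : ℝ) :
    ∀ᶠ x in nhdsWithin s (Set.Ioi s), ∀ k, χ k ≤ x ↔ χ k ≤ s := by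
  rw [Filter.eventually_all]
  intro k
  rcases le_or_gt (χ k) s with h | h
  · filter_upwards [self_mem_nhdsWithin] with x hx
    exact ⟨fun _ => h, fun _ => h.trans (le_of_lt hx)⟩
  · filter_upwards [nhdsWithin_le_nhds (Iio_mem_nhds h)] with x hx
    exact ⟨fun h' => absurd hx (not_lt.2 h'), fun h' => absurd h (not_lt.2 h')⟩

theorem eventually_nhdsLT_le_iff (χ : Fin n → ℝ) (s : ℝ) :
    ∀ᶠ x in nhdsWithin s (Set.Iio s), ∀ k, χ k ≤ x ↔ χ k < s := by
  rw [Filter.eventually_all]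
  intro k
  rcases lt_or_ge (χ k) s with h | h
  · filter_upwards [nhdsWithin_le_nhds (Ioi_mem_nhds h)] with x hx
    exact ⟨fun _ => h, fun _ => le_of_lt hx⟩
  · filter_upwards [self_mem_nhdsWithin] with x hx
    exact ⟨fun h' => lt_of_le_of_lt h' hx, fun h' => absurd h (not_le.2 h')⟩

theorem tendsto_bridge_nhdsLT (p χ : Fin n → ℝ) (s : ℝ) :
    Filter.Tendsto (bridge p χ) (nhdsWithin s (Set.Iio s)) (nhds (leftBridge p χ s)) := by
  have h : Filter.Tendsto (fun x => -x + ∑ i, p i * (if χ i < s then 1 else 0))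
      (nhdsWithin s (Set.Iio s)) (nhds (leftBridge p χ s)) := by
    refine (Continuous.tendsto (by fun_prop) s).mono_left nhdsWithin_le_nhds
  refine h.congr' ?_
  filter_upwards [eventually_nhdsLT_le_iff χ s] with x hx
  simp only [bridge, hx]

theorem leftLim_bridge (p χ : Fin n → ℝ) (s : ℝ) :
    Function.leftLim (bridge p χ) s = leftBridge p χ s :=
  leftLim_eq_of_tendsto (tendsto_bridge_nhdsLT p χ s)

theorem leftBridge_le_bridge {p : Fin n → ℝ} (hp : ∀ i, 0 < p i) (χ : Fin n → ℝ) (s : ℝ) :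
    leftBridge p χ s ≤ bridge p χ s := by
  refine add_le_add_right (Finset.sum_le_sum fun i _ => ?_) _
  refine mul_le_mul_of_nonneg_left ?_ (hp i).le
  split_ifs with h1 h2
  · exact le_rfl
  · exact absurd h1.le h2
  · exact zero_le_one
  · exact le_rfl

/-- The bridge `bridge p b` on `[0, 1]`, extended by `0`. -/
noncomputable def excursion (p b : Fin n → ℝ) : ℝ → ℝ :=
  (Set.Icc 0 1).indicator (bridge p b)

end path

namespace LabelledRootedTree.IsSchedule

variable {n : ℕ} {t : LabelledRootedTree n} {p b : Fin n → ℝ}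

theorem anc_iff' (hp : ∀ i, 0 < p i) (hb : t.IsSchedule p b) {i l : Fin n} :
    t.Anc i l ↔ b i ≤ b l ∧ b l < b i + t.mass p i := by
  constructor
  · intro h
    have h1 := (hb.anc_iff i l).1 h
    have h2 := hb.add_mass_le i l h
    have h3 := t.mass_pos hp l
    exact ⟨h1.1, by linarith⟩
  · rintro ⟨h1, h2⟩
    exact (hb.anc_iff i l).2 ⟨h1, h2.le⟩

theorem injective (hp : ∀ i, 0 < p i) (hb : t.IsSchedule p b) : Function.Injective b := by
  intro i j hij
  have h1 := t.mass_pos hp i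
  have h2 := t.mass_pos hp j
  exact Anc.antisymm ((hb.anc_iff i j).2 ⟨hij.le, by linarith⟩)
    ((hb.anc_iff j i).2 ⟨hij.ge, by linarith⟩)

theorem lt_of_isChild (hp : ∀ i, 0 < p i) (hb : t.IsSchedule p b) {i j : Fin n}
    (h : t.IsChild i j) : b i < b j := by
  refine lt_of_le_of_ne ((hb.anc_iff i j).1 h.anc).1 fun he => ?_
  exact h.1.ne (hb.injective hp he)

theorem nonneg (hb : t.IsSchedule p b) (j : Fin n) : 0 ≤ b j := by
  have := ((hb.anc_iff _ j).1 (t.anc_root j)).1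
  rwa [hb.root] at this

theorem add_mass_le_one (hs : ∑ i, p i = 1) (hb : t.IsSchedule p b) (j : Fin n) :
    b j + t.mass p j ≤ 1 := by
  have := hb.add_mass_le _ j (t.anc_root j)
  rwa [hb.root, mass_root, hs, zero_add] at this

theorem lt_one (hp : ∀ i, 0 < p i) (hs : ∑ i, p i = 1) (hb : t.IsSchedule p b) (j : Fin n) :
    b j < 1 := by
  have h1 := hb.add_mass_le_one hs j
  have h2 := t.mass_pos hp j
  linarith

theorem leftBridge_le (hb : t.IsSchedule p b) {i j : Fin n} (h : t.Anc i j) :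
    leftBridge p b (b i) ≤ leftBridge p b (b j) := by
  induction h with
  | refl => exact le_rfl
  | tail _ h ih => exact ih.trans (hb.leftBridge_lt _ _ h).le

theorem leftBridge_zero (hb : t.IsSchedule p b) : leftBridge p b 0 = 0 := by
  simp [leftBridge, fun j => not_lt.2 (hb.nonneg j)]

theorem leftBridge_pos (hb : t.IsSchedule p b) {j : Fin n} (hj : j ≠ t.root) :
    0 < leftBridge p b (b j) := by
  rcases (t.anc_root j).eq_or_exists_isChild with h | ⟨k, hk, hkj⟩
  · exact absurd h.symm hj
  · have h1 := hb.leftBridge_lt _ _ hk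
    rw [hb.root, hb.leftBridge_zero] at h1
    exact h1.trans_le (hb.leftBridge_le hkj)

/-- The arrivals in `[b i, b i + t.mass p i]` are exactly the descendants of `i`, whose total load
equals the time elapsed. -/
theorem bridge_add_mass (hb : t.IsSchedule p b) (i : Fin n) :
    bridge p b (b i + t.mass p i) = leftBridge p b (b i) := by
  classical
  have h : ∑ k, p k * (if b k ≤ b i + t.mass p i then (1 : ℝ) else 0) =
      ∑ k, p k * (if b k < b i then 1 else 0) + t.mass p i := by
    have h0 : 0 ≤ t.mass p i := by
      have := ((hb.anc_iff i i).1 (Anc.refl t i)).2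
      linarith
    have hm : t.mass p i = ∑ k, if t.Anc i k then p k else 0 := by rw [mass, Finset.sum_filter]
    refine Eq.trans ?_ (congrArg₂ _ rfl hm.symm)
    rw [← Finset.sum_add_distrib]
    refine Finset.sum_congr rfl fun k _ => ?_
    rcases lt_or_ge (b k) (b i) with h1 | h1
    · have h2 : ¬ t.Anc i k := fun h => absurd ((hb.anc_iff i k).1 h).1 (not_le.2 h1)
      rw [if_pos (by linarith), if_pos h1, if_neg h2]
      ring
    · rw [if_neg (not_lt.2 h1)]
      by_cases h2 : t.Anc i k
      · rw [if_pos ((hb.anc_iff i k).1 h2).2, if_pos h2]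
        ring
      · rw [if_neg fun h => h2 ((hb.anc_iff i k).2 ⟨h1, h⟩), if_neg h2]
        ring
  rw [bridge, leftBridge, h]
  ring

/-- While a customer is in the queue, the load exceeds its level prior to his arrival. -/
theorem leftBridge_lt_bridge (hb : t.IsSchedule p b) {i : Fin n} {s : ℝ} (h1 : b i ≤ s)
    (h2 : s < b i + t.mass p i) : leftBridge p b (b i) < bridge p b s := by
  classical
  -- After `s` the load decreases with slope `-1` until the next arrival `k`, or until the end of
  -- the interval. The value reached there is at least the level before `i`, because `k` descends
  -- from `i`.
  rcases (Finset.univ.filter fun k => s < b k ∧ b k ≤ b i + t.mass p i).eq_empty_or_nonempty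
    with h | h
  · rw [← hb.bridge_add_mass, bridge, bridge]
    have h3 : ∀ k, b k ≤ s ↔ b k ≤ b i + t.mass p i := fun k =>
      ⟨fun hk => hk.trans h2.le, fun hk => by
        by_contra hks
        have : k ∈ (Finset.univ.filter fun k => s < b k ∧ b k ≤ b i + t.mass p i) := by
          simpa using ⟨not_le.1 hks, hk⟩
        rw [h] at this
        exact absurd this (Finset.notMem_empty k)⟩
    simp only [h3]
    linarith
  · obtain ⟨k, hk, hmin⟩ := Finset.exists_min_image _ b h
    simp only [Finset.mem_filter, Finset.mem_univ, true_and, and_imp] at hk hmin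
    have h3 : ∀ l, b l ≤ s ↔ b l < b k := fun l =>
      ⟨fun hl => hl.trans_lt hk.1, fun hl => by
        by_contra hls
        exact absurd (hmin l (not_le.1 hls) (hl.le.trans hk.2)) (not_le.2 hl)⟩
    have h4 := hb.leftBridge_le ((hb.anc_iff i k).2 ⟨by linarith [hk.1], hk.2⟩)
    refine h4.trans_lt ?_
    rw [bridge, leftBridge]
    simp only [h3]
    linarith [hk.1]

theorem bridge_pos (hs : ∑ i, p i = 1) (hb : t.IsSchedule p b) {s : ℝ} (h0 : 0 ≤ s)
    (h1 : s < 1) : 0 < bridge p b s := by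
  have := hb.leftBridge_lt_bridge (i := t.root) (s := s) (by rwa [hb.root])
    (by rwa [hb.root, mass_root, hs, zero_add])
  rwa [hb.root, hb.leftBridge_zero] at this

theorem bridge_one (hp : ∀ i, 0 < p i) (hs : ∑ i, p i = 1) (hb : t.IsSchedule p b) :
    bridge p b 1 = 0 := by
  simp [bridge, fun j => (hb.lt_one hp hs j).le, hs]

theorem leftBridge_one (hp : ∀ i, 0 < p i) (hs : ∑ i, p i = 1) (hb : t.IsSchedule p b) :
    leftBridge p b 1 = 0 := by
  simp [leftBridge, fun j => hb.lt_one hp hs j, hs]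

theorem leftLim_excursion (hp : ∀ i, 0 < p i) (hs : ∑ i, p i = 1) (hb : t.IsSchedule p b)
    (i : Fin n) : Function.leftLim (excursion p b) (b i) = leftBridge p b (b i) := by
  apply leftLim_eq_of_tendsto
  rcases (hb.nonneg i).eq_or_lt with h | h
  · rw [← h, hb.leftBridge_zero]
    refine tendsto_const_nhds.congr' ?_
    filter_upwards [self_mem_nhdsWithin] with x hx
    rw [excursion, Set.indicator_of_notMem]
    exact fun hx' => absurd hx'.1 (not_le.2 hx)
  · refine (tendsto_bridge_nhdsLT p b (b i)).congr' ?_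
    filter_upwards [self_mem_nhdsWithin, nhdsWithin_le_nhds (Ioi_mem_nhds h)] with x hx hx'
    rw [excursion, Set.indicator_of_mem]
    exact ⟨le_of_lt hx', (lt_trans hx (hb.lt_one hp hs i)).le⟩

/-- The load exceeds its level before `i` throughout the interval of `i`, returns to it at the end,
and, when this end is before time `1`, falls below it at once. The root is why `s < 1` is required:
the path vanishes after time `1` and never becomes negative, so the departure of the root is `⊤`. -/
theorem inQueue_iff (hp : ∀ i, 0 < p i) (hs : ∑ i, p i = 1) (hb : t.IsSchedule p b)
    {i : Fin n} {s : ℝ} (h1 : s < 1) :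
    InQueue (excursion p b) b i s ↔ b i < s ∧ s < b i + t.mass p i := by
  refine and_congr_right fun his => ?_
  rw [departure, hb.leftLim_excursion hp hs]
  constructor
  · intro h
    by_contra hn
    have hi : i ≠ t.root := by
      rintro rfl
      rw [hb.root, mass_root, hs, zero_add] at hn
      exact hn h1
    obtain ⟨q, hq1, hq2⟩ := EReal.lt_iff_exists_real_btwn.1 h
    have hsq : b i + t.mass p i < q := (not_lt.1 hn).trans_lt (EReal.coe_lt_coe_iff.1 hq1)
    have h2 : b i + t.mass p i < 1 := (not_lt.1 hn).trans_lt h1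
    obtain ⟨x, hx, ⟨hxe, hxq⟩, -, hx1⟩ := ((eventually_nhdsGT_le_iff b _).and
      (Filter.Eventually.and (Ioo_mem_nhdsGT hsq) (Ioo_mem_nhdsGT h2))).exists
    have h3 := t.mass_pos hp i
    have h4 : excursion p b x < leftBridge p b (b i) := by
      rw [excursion, Set.indicator_of_mem (Set.mem_Icc.2 ⟨by linarith [hb.nonneg i], hx1.le⟩),
        ← hb.bridge_add_mass, bridge, bridge]
      simp only [hx]
      linarith
    have h5 : sInf ((fun t : ℝ => (t : EReal)) ''
        {t | b i < t ∧ excursion p b t < leftBridge p b (b i)}) ≤ x :=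
      sInf_le ⟨x, ⟨by linarith, h4⟩, rfl⟩
    exact absurd (h5.trans_lt (EReal.coe_lt_coe_iff.2 hxq)) (not_lt.2 hq2.le)
  · intro h
    refine (EReal.coe_lt_coe_iff.2 h).trans_le (le_sInf ?_)
    rintro _ ⟨x, ⟨hx, hx'⟩, rfl⟩
    refine EReal.coe_le_coe_iff.2 ?_
    by_contra hn
    have h2 := hb.leftBridge_lt_bridge hx.le (not_le.1 hn)
    have h3 := hb.add_mass_le_one hs i
    rw [excursion, Set.indicator_of_mem (Set.mem_Icc.2 ⟨by linarith [hb.nonneg i], by linarith⟩)]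
      at hx'
    exact lt_asymm h2 hx'

theorem inQueue_arrival_iff (hp : ∀ i, 0 < p i) (hs : ∑ i, p i = 1) (hb : t.IsSchedule p b)
    {i j : Fin n} : InQueue (excursion p b) b i (b j) ↔ i ≠ j ∧ t.Anc i j := by
  rw [hb.inQueue_iff hp hs (hb.lt_one hp hs j), hb.anc_iff' hp]
  constructor
  · rintro ⟨h1, h2⟩
    exact ⟨fun h => by simp [h] at h1, h1.le, h2⟩
  · rintro ⟨h1, h2, h3⟩
    exact ⟨lt_of_le_of_ne h2 fun h => h1 (hb.injective hp h), h3⟩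

/-- Just before `j` arrives the queue consists of the strict ancestors of `j`; the last of them to
arrive is the parent. -/
theorem isLIFOTree (hp : ∀ i, 0 < p i) (hs : ∑ i, p i = 1) (hb : t.IsSchedule p b) :
    IsLIFOTree (excursion p b) b t := by
  refine ⟨fun j => hb.root.trans_le (hb.nonneg j), fun i j => ?_⟩
  rw [InService, hb.inQueue_arrival_iff hp hs]
  simp only [hb.inQueue_arrival_iff hp hs]
  constructor
  · intro h
    refine ⟨⟨h.1.ne, h.anc⟩, fun k hk => ?_⟩
    exact ((hb.anc_iff k i).1 ((h.anc_iff.1 hk.2).resolve_left hk.1)).1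
  · rintro ⟨⟨hij, hanc⟩, hmax⟩
    have hj : j ≠ t.root := by
      rintro rfl
      exact hij (anc_root_iff.1 hanc)
    obtain ⟨h, hhj⟩ := t.exists_isChild hj
    have h1 := hmax h ⟨hhj.1.ne, hhj.anc⟩
    have h2 := ((hb.anc_iff i h).1 ((hhj.anc_iff.1 hanc).resolve_left hij)).1
    rwa [hb.injective hp (le_antisymm h2 h1)]

theorem inService_iff (hp : ∀ i, 0 < p i) (hs : ∑ i, p i = 1) (hb : t.IsSchedule p b)
    {i : Fin n} {s : ℝ} (h1 : s < 1) :
    InService (excursion p b) b i s ↔ s ∈ Set.Ioo (b i) (b i + t.mass p i) ∧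
      ∀ k, t.IsChild i k → s ∉ Set.Ioo (b k) (b k + t.mass p k) := by
  rw [InService, hb.inQueue_iff hp hs h1]
  simp only [hb.inQueue_iff hp hs h1]
  refine and_congr_right fun hi => ⟨fun h k hk hsk => ?_, fun h k hk => ?_⟩
  · exact absurd (h k hsk) (not_le.2 (hb.lt_of_isChild hp hk))
  · by_contra hn
    have h2 : t.Anc i k := (hb.anc_iff' hp).2 ⟨(not_le.1 hn).le, hk.1.trans hi.2⟩
    rcases h2.eq_or_exists_isChild with rfl | ⟨l, hl, hlk⟩
    · exact hn le_rfl
    · exact h l hl ⟨((hb.anc_iff l k).1 hlk).1.trans_lt hk.1,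
        hk.2.trans_le (hb.add_mass_le l k hlk)⟩

/-- Up to the point `1`, the service set is the interval of `i` with the disjoint intervals of its
children removed, which leaves length `p i` by `mass_eq`. -/
theorem volume_inService (hp : ∀ i, 0 < p i) (hs : ∑ i, p i = 1) (hb : t.IsSchedule p b)
    (i : Fin n) : volume {s : ℝ | s ∈ Set.Icc (0 : ℝ) 1 ∧ InService (excursion p b) b i s} =
      ENNReal.ofReal (p i) := by
  classical
  have h1 : {s : ℝ | s ∈ Set.Icc (0 : ℝ) 1 ∧ InService (excursion p b) b i s}
      =ᵐ[volume] (Set.Ioo (b i) (b i + t.mass p i) \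
        ⋃ k ∈ Finset.univ.filter (fun k => t.IsChild i k),
          Set.Ioo (b k) (b k + t.mass p k) : Set ℝ) := by
    refine Filter.eventuallyEq_set.2 ?_
    have h2 : ∀ᵐ s : ℝ, s ≠ 1 := by simp [ae_iff]
    filter_upwards [h2] with s hs1
    rw [Set.mem_sdiff]
    rcases lt_or_gt_of_ne hs1 with h | h
    · rw [hb.inService_iff hp hs h]
      simp only [Set.mem_iUnion, Finset.mem_filter, Finset.mem_univ, true_and, not_exists]
      refine ⟨fun h => h.2, fun h' => ⟨⟨?_, h.le⟩, h'⟩⟩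
      exact (hb.nonneg i).trans h'.1.1.le
    · refine ⟨fun h' => absurd h'.1.2 (not_le.2 h), fun h' => absurd h'.1.2 (not_lt.2 ?_)⟩
      exact (hb.add_mass_le_one hs i).trans h.le
  rw [measure_congr h1, measure_sdiff]
  · rw [measure_biUnion_finset]
    · simp only [Real.volume_Ioo, add_sub_cancel_left]
      rw [← ENNReal.ofReal_sum_of_nonneg fun k _ => (t.mass_pos hp k).le, ← ENNReal.ofReal_sub,
        t.mass_eq p i, add_sub_cancel_right]
      exact Finset.sum_nonneg fun k _ => (t.mass_pos hp k).le
    · intro k hk l hl hkl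
      rw [Finset.mem_coe, Finset.mem_filter] at hk hl
      rw [Function.onFun, Set.disjoint_left]
      rintro x ⟨hx1, hx2⟩ ⟨hx3, hx4⟩
      rcases le_total (b k) (b l) with h | h
      · exact hkl (hk.2.eq_of_anc hl.2 ((hb.anc_iff' hp).2 ⟨h, hx3.trans hx2⟩) (Anc.refl t l))
      · exact hkl (hk.2.eq_of_anc hl.2 (Anc.refl t k) ((hb.anc_iff' hp).2 ⟨h, hx1.trans hx4⟩))
    · exact fun _ _ => measurableSet_Ioo
  · refine Set.iUnion₂_subset fun k hk => ?_
    rw [Finset.mem_filter] at hk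
    exact Set.Ioo_subset_Ioo (hb.lt_of_isChild hp hk.2).le (hb.add_mass_le i k hk.2.anc)
  · exact (Finset.measurableSet_biUnion _ fun _ _ => measurableSet_Ioo).nullMeasurableSet
  · refine ne_top_of_le_ne_top (b := ENNReal.ofReal (t.mass p i)) ENNReal.ofReal_ne_top ?_
    refine (measure_mono (t := Set.Ioo (b i) (b i + t.mass p i)) ?_).trans (by simp)
    refine Set.iUnion₂_subset fun k hk => ?_
    rw [Finset.mem_filter] at hk
    exact Set.Ioo_subset_Ioo (hb.lt_of_isChild hp hk.2).le (hb.add_mass_le i k hk.2.anc)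

end LabelledRootedTree.IsSchedule

end PTree

/-! ### Cyclic rotation and the Vervaat transform. -/

namespace PTree

section rotation

variable {n : ℕ} {p b : Fin n → ℝ} {u : ℝ}

theorem fract_add_eq_ite {u s : ℝ} (hu0 : 0 ≤ u) (hu1 : u < 1) (hs0 : 0 ≤ s) (hs1 : s < 1) :
    Int.fract (u + s) = u + s - (if u + s < 1 then 0 else 1) := by
  split_ifs with h
  · rw [Int.fract_eq_self.2 ⟨by linarith, h⟩, sub_zero]
  · rw [Int.fract_eq_iff]
    exact ⟨by linarith, by linarith, 1, by simp⟩

/-- Rotation adds the jumps lying before `u`, independently of `s`, and subtracts `1` when `u + s`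
wraps around. Weighted by `p`, whose total is `1`, the latter cancels against the drift in
`bridge_fract`. -/
theorem ite_fract_le {b u s : ℝ} (hu0 : 0 ≤ u) (hu1 : u < 1) (hs0 : 0 ≤ s) (hs1 : s < 1)
    (hb0 : 0 ≤ b) (hb1 : b < 1) :
    (if Int.fract (u + b) ≤ Int.fract (u + s) then 1 else 0 : ℝ) = (if b ≤ s then 1 else 0) +
      (if Int.fract (u + b) < u then 1 else 0) - (if u + s < 1 then 0 else 1) := by
  rw [fract_add_eq_ite hu0 hu1 hs0 hs1, fract_add_eq_ite hu0 hu1 hb0 hb1]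
  split_ifs <;> linarith

theorem ite_fract_lt {b u s : ℝ} (hu0 : 0 ≤ u) (hu1 : u < 1) (hs0 : 0 ≤ s) (hs1 : s < 1)
    (hb0 : 0 ≤ b) (hb1 : b < 1) :
    (if Int.fract (u + b) < Int.fract (u + s) then 1 else 0 : ℝ) = (if b < s then 1 else 0) +
      (if Int.fract (u + b) < u then 1 else 0) - (if u + s < 1 then 0 else 1) := by
  rw [fract_add_eq_ite hu0 hu1 hs0 hs1, fract_add_eq_ite hu0 hu1 hb0 hb1]
  split_ifs <;> linarith

theorem bridge_fract (hs : ∑ i, p i = 1) (hb0 : ∀ i, 0 ≤ b i) (hb1 : ∀ i, b i < 1)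
    (hu0 : 0 ≤ u) (hu1 : u < 1) {s : ℝ} (hs0 : 0 ≤ s) (hs1 : s < 1) :
    bridge p (fun j => Int.fract (u + b j)) (Int.fract (u + s)) =
      bridge p b s + leftBridge p (fun j => Int.fract (u + b j)) u := by
  rw [bridge, bridge, leftBridge]
  simp only [ite_fract_le hu0 hu1 hs0 hs1 (hb0 _) (hb1 _), mul_sub, mul_add,
    Finset.sum_sub_distrib, Finset.sum_add_distrib, ← Finset.sum_mul, hs]
  rw [fract_add_eq_ite hu0 hu1 hs0 hs1]
  ring

theorem leftBridge_fract (hs : ∑ i, p i = 1) (hb0 : ∀ i, 0 ≤ b i) (hb1 : ∀ i, b i < 1)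
    (hu0 : 0 ≤ u) (hu1 : u < 1) {s : ℝ} (hs0 : 0 ≤ s) (hs1 : s < 1) :
    leftBridge p (fun j => Int.fract (u + b j)) (Int.fract (u + s)) =
      leftBridge p b s + leftBridge p (fun j => Int.fract (u + b j)) u := by
  rw [leftBridge, leftBridge, leftBridge]
  simp only [ite_fract_lt hu0 hu1 hs0 hs1 (hb0 _) (hb1 _), mul_sub, mul_add,
    Finset.sum_sub_distrib, Finset.sum_add_distrib, ← Finset.sum_mul, hs]
  rw [fract_add_eq_ite hu0 hu1 hs0 hs1]
  ring

theorem fract_add_fract_sub {u v : ℝ} (hv0 : 0 ≤ v) (hv1 : v < 1) :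
    Int.fract (u + Int.fract (v - u)) = v := by
  rw [Int.fract_eq_iff]
  refine ⟨hv0, hv1, -⌊v - u⌋, ?_⟩
  have := Int.self_sub_fract (v - u)
  push_cast
  linarith

theorem fract_fract_add_sub {u b : ℝ} (hb0 : 0 ≤ b) (hb1 : b < 1) :
    Int.fract (Int.fract (u + b) - u) = b := by
  rw [Int.fract_eq_iff]
  refine ⟨hb0, hb1, -⌊u + b⌋, ?_⟩
  have := Int.self_sub_fract (u + b)
  push_cast
  linarith

end rotation

namespace LabelledRootedTree.IsSchedule

variable {n : ℕ} {t : LabelledRootedTree n} {p b : Fin n → ℝ} {u : ℝ}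

theorem leftBridge_pos' (hs : ∑ i, p i = 1) (hb : t.IsSchedule p b) {s : ℝ} (h0 : 0 < s)
    (h1 : s < 1) : 0 < leftBridge p b s := by
  by_cases h : ∃ k, b k = s
  · obtain ⟨k, rfl⟩ := h
    refine hb.leftBridge_pos ?_
    rintro rfl
    exact h0.ne' hb.root
  · push Not at h
    have h2 := hb.bridge_pos hs h0.le h1
    rw [bridge] at h2
    rw [leftBridge]
    simpa only [(h _).le_iff_lt] using h2

/-- Up to a constant, the rotated bridge is the schedule's bridge started at `u`. The latter and its
left limits are positive inside `(0, 1)`, so the infimum is reached at `u` only, as a left limit. -/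
theorem infPoint_bridge (hp : ∀ i, 0 < p i) (hs : ∑ i, p i = 1) (hb : t.IsSchedule p b)
    (hu0 : 0 < u) (hu1 : u < 1) (hχ : ∀ j, Int.fract (u + b j) ≠ 0) :
    min (Function.leftLim (bridge p fun j => Int.fract (u + b j)) u)
      (bridge p (fun j => Int.fract (u + b j)) u) =
        leftBridge p (fun j => Int.fract (u + b j)) u ∧
    infPoint (bridge p fun j => Int.fract (u + b j)) = u := by
  set χ : Fin n → ℝ := fun j => Int.fract (u + b j) with hχ_def
  have hb1 := hb.lt_one hp hs
  have hχ0 : ∀ j, 0 < χ j := fun j => lt_of_le_of_ne (Int.fract_nonneg _) (hχ j).symm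
  have hχ1 : ∀ j, χ j < 1 := fun j => Int.fract_lt_one _
  have hmin : min (Function.leftLim (bridge p χ) u) (bridge p χ u) = leftBridge p χ u := by
    rw [leftLim_bridge, min_eq_left (leftBridge_le_bridge hp χ u)]
  have hzero : bridge p χ 0 = 0 := by simp [bridge, fun j => not_le.2 (hχ0 j)]
  have hone : bridge p χ 1 = 0 := by simp [bridge, fun j => (hχ1 j).le, hs]
  have hleft : leftBridge p χ 1 = 0 := by simp [leftBridge, hχ1, hs]
  have hgt : ∀ v, 0 ≤ v → v < 1 → leftBridge p χ u < bridge p χ v := by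
    intro v hv0 hv1
    rw [← fract_add_fract_sub (u := u) hv0 hv1, bridge_fract hs hb.nonneg hb1 hu0.le hu1
      (Int.fract_nonneg _) (Int.fract_lt_one _)]
    have := hb.bridge_pos hs (Int.fract_nonneg (v - u)) (Int.fract_lt_one _)
    linarith
  have hneg : leftBridge p χ u < 0 := (hgt 0 le_rfl zero_lt_one).trans_eq hzero
  have hgt' : ∀ v, 0 < v → v < 1 → v ≠ u → leftBridge p χ u < leftBridge p χ v := by
    intro v hv0 hv1 hvu
    rw [← fract_add_fract_sub (u := u) hv0.le hv1, leftBridge_fract hs hb.nonneg hb1 hu0.le hu1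
      (Int.fract_nonneg _) (Int.fract_lt_one _)]
    have hne : Int.fract (v - u) ≠ 0 := by
      intro h
      have h' := fract_add_fract_sub (u := u) hv0.le hv1
      rw [h, add_zero, Int.fract_eq_self.2 ⟨hu0.le, hu1⟩] at h'
      exact hvu h'.symm
    have := hb.leftBridge_pos' hs (lt_of_le_of_ne (Int.fract_nonneg (v - u)) hne.symm)
      (Int.fract_lt_one _)
    linarith
  have hinf : sInf (bridge p χ '' Set.Icc 0 1) = leftBridge p χ u := by
    refine csInf_eq_of_forall_ge_of_forall_gt_exists_lt ⟨_, 0, by simp, rfl⟩ ?_ ?_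
    · rintro _ ⟨v, ⟨hv0, hv1⟩, rfl⟩
      rcases hv1.eq_or_lt with rfl | hv1
      · rw [hone]
        exact hneg.le
      · exact (hgt v hv0 hv1).le
    -- The bridge does not attain its infimum, since it jumps up at `u`; values just to the left of
    -- `u` approach it.
    · intro w hw
      obtain ⟨x, hx, hx0, hxu⟩ := (((tendsto_bridge_nhdsLT p χ u).eventually
        (Iio_mem_nhds hw)).and (Ioo_mem_nhdsLT hu0)).exists
      exact ⟨_, ⟨x, ⟨hx0.le, (hxu.trans hu1).le⟩, rfl⟩, hx⟩
  refine ⟨hmin, ?_⟩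
  have hset : {v | 0 < v ∧ v ≤ 1 ∧ min (bridge p χ v) (Function.leftLim (bridge p χ) v) =
      sInf (bridge p χ '' Set.Icc 0 1)} = {u} := by
    ext v
    rw [Set.mem_singleton_iff]
    constructor
    · rintro ⟨hv0, hv1, hv⟩
      rw [hinf, leftLim_bridge, min_eq_right (leftBridge_le_bridge hp χ v)] at hv
      by_contra hvu
      rcases hv1.eq_or_lt with rfl | hv1
      · rw [hleft] at hv
        exact hneg.ne hv.symm
      · exact (hgt' v hv0 hv1 hvu).ne hv.symm
    · rintro rfl
      exact ⟨hu0, hu1.le, by rw [hinf, min_comm, hmin]⟩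
  rw [infPoint, hset, csInf_singleton]

theorem vervaat_bridge (hp : ∀ i, 0 < p i) (hs : ∑ i, p i = 1) (hb : t.IsSchedule p b)
    (hu0 : 0 < u) (hu1 : u < 1) (hχ : ∀ j, Int.fract (u + b j) ≠ 0) :
    vervaat (bridge p fun j => Int.fract (u + b j)) = excursion p b := by
  obtain ⟨h1, h2⟩ := hb.infPoint_bridge hp hs hu0 hu1 hχ
  have hshift : ∀ s, 0 ≤ s → s < 1 →
      vervaatShift (bridge p fun j => Int.fract (u + b j)) s = bridge p b s := by
    intro s hs0 hs1
    rw [vervaatShift, h2, h1, bridge_fract hs hb.nonneg (hb.lt_one hp hs) hu0.le hu1 hs0 hs1,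
      add_sub_cancel_right]
  funext s
  rw [vervaat, excursion]
  split_ifs with h3 h4 h5
  · rw [Set.indicator_of_notMem fun h => absurd h.1 (not_le.2 h3)]
  · rw [Set.indicator_of_mem (Set.mem_Icc.2 ⟨not_lt.1 h3, h4.le⟩), hshift s (not_lt.1 h3) h4]
  · rw [h5, Set.indicator_of_mem (by simp), hb.bridge_one hp hs, ← hb.leftBridge_one hp hs]
    apply leftLim_eq_of_tendsto
    refine (tendsto_bridge_nhdsLT p b 1).congr' ?_
    filter_upwards [Ioo_mem_nhdsLT zero_lt_one] with x hx
    exact (hshift x hx.1.le hx.2).symm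
  · rw [Set.indicator_of_notMem fun h => h5 (le_antisymm h.2 (not_lt.1 h4))]

theorem arrival_eq (hp : ∀ i, 0 < p i) (hs : ∑ i, p i = 1) (hb : t.IsSchedule p b)
    (hu0 : 0 < u) (hu1 : u < 1) (hχ : ∀ j, Int.fract (u + b j) ≠ 0) :
    arrival p (fun j => Int.fract (u + b j)) = b := by
  funext j
  rw [arrival, (hb.infPoint_bridge hp hs hu0 hu1 hχ).2]
  exact fract_fract_add_sub (hb.nonneg j) (hb.lt_one hp hs j)

end LabelledRootedTree.IsSchedule

theorem lifoTree_eq_some {n : ℕ} {x : ℝ → ℝ} {a : Fin n → ℝ} {t : LabelledRootedTree n}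
    (h : IsLIFOTree x a t) : lifoTree x a = some t := by
  have h' : ∃ t, IsLIFOTree x a t := ⟨t, h⟩
  rw [lifoTree, dif_pos h', h'.choose_spec.unique h]

namespace LabelledRootedTree

variable {n : ℕ} {t : LabelledRootedTree n} {p y : Fin n → ℝ}

/-- The jump times of the bridge associated with the service requirements `y`. -/
noncomputable def jumpTimes (t : LabelledRootedTree n) (p y : Fin n → ℝ) (j : Fin n) : ℝ :=
  Int.fract (t.position p y j)

theorem jumpTimes_eq (t : LabelledRootedTree n) (p y : Fin n → ℝ) :
    t.jumpTimes p y = fun j => Int.fract (y t.root + (t.position p y j - y t.root)) := by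
  funext j
  rw [jumpTimes, add_sub_cancel]

theorem Admissible.fract_ne' (hy : t.Admissible p y) (j : Fin n) :
    Int.fract (y t.root + (t.position p y j - y t.root)) ≠ 0 := by
  rw [add_sub_cancel]
  exact hy.fract_ne j

theorem Admissible.lifoTree_eq (hp : ∀ i, 0 < p i) (hs : ∑ i, p i = 1)
    (hy : t.Admissible p y) : lifoTree (vervaat (bridge p (t.jumpTimes p y)))
      (arrival p (t.jumpTimes p y)) = some t := by
  rw [jumpTimes_eq, (hy.isSchedule hp).vervaat_bridge hp hs hy.root_pos hy.root_lt hy.fract_ne',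
    (hy.isSchedule hp).arrival_eq hp hs hy.root_pos hy.root_lt hy.fract_ne']
  exact lifoTree_eq_some ((hy.isSchedule hp).isLIFOTree hp hs)

theorem Admissible.volume_inService (hp : ∀ i, 0 < p i) (hs : ∑ i, p i = 1)
    (hy : t.Admissible p y) (i : Fin n) :
    volume {s : ℝ | s ∈ Set.Icc (0 : ℝ) 1 ∧ InService (vervaat (bridge p (t.jumpTimes p y)))
      (arrival p (t.jumpTimes p y)) i s} = ENNReal.ofReal (p i) := by
  rw [jumpTimes_eq, (hy.isSchedule hp).vervaat_bridge hp hs hy.root_pos hy.root_lt hy.fract_ne',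
    (hy.isSchedule hp).arrival_eq hp hs hy.root_pos hy.root_lt hy.fract_ne']
  exact (hy.isSchedule hp).volume_inService hp hs i

end LabelledRootedTree

end PTree

/-! ### Genericity and the change of variables. -/

namespace PTree

section generic

variable {n : ℕ}

/-- The additive group generated by `1` and the masses `p i`. -/
def massGroup (p : Fin n → ℝ) : Submodule ℤ ℝ :=
  Submodule.span ℤ (Set.range fun o : Option (Fin n) => o.elim 1 p)

theorem countable_massGroup (p : Fin n → ℝ) : (massGroup p : Set ℝ).Countable := by
  have : Countable (massGroup p) := inferInstanceAs
    (Countable (Submodule.span ℤ (Set.range fun o : Option (Fin n) => o.elim 1 p)))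
  exact Set.to_countable _

theorem mem_massGroup (p : Fin n → ℝ) (i : Fin n) : p i ∈ massGroup p :=
  Submodule.subset_span ⟨some i, rfl⟩

theorem intCast_mem_massGroup (p : Fin n → ℝ) (k : ℤ) : (k : ℝ) ∈ massGroup p := by
  have h : (1 : ℝ) ∈ massGroup p := Submodule.subset_span ⟨none, rfl⟩
  simpa using (massGroup p).smul_mem k h

theorem sum_mul_ite_mem_massGroup (p : Fin n → ℝ) (C : Fin n → Prop) [DecidablePred C] :
    ∑ i, p i * (if C i then 1 else 0) ∈ massGroup p := by
  refine Submodule.sum_mem _ fun i _ => ?_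
  split_ifs
  · rw [mul_one]
    exact mem_massGroup p i
  · rw [mul_zero]
    exact zero_mem _

theorem mass_mem_massGroup (t : LabelledRootedTree n) (p : Fin n → ℝ) (i : Fin n) :
    t.mass p i ∈ massGroup p :=
  Submodule.sum_mem _ fun j _ => mem_massGroup p j

/-- A nonzero linear functional avoids almost surely a given countable set. -/
theorem ae_linearMap_notMem (f : (Fin n → ℝ) →ₗ[ℝ] ℝ) {v : Fin n → ℝ} (hf : f v ≠ 0)
    {D : Set ℝ} (hD : D.Countable) : ∀ᵐ y : Fin n → ℝ, f y ∉ D := by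
  have h : ∀ᵐ y : Fin n → ℝ, ∀ c ∈ D, f y ≠ c := by
    rw [ae_ball_iff hD]
    intro c _
    rw [ae_iff]
    simp only [ne_eq, not_not]
    let S : AffineSubspace ℝ (Fin n → ℝ) := (AffineSubspace.mk' c ⊥).comap f.toAffineMap
    have hS : (S : Set (Fin n → ℝ)) = {y | f y = c} := by
      ext y
      simp [S, sub_eq_zero]
    rw [← hS]
    refine Measure.addHaar_affineSubspace _ S fun htop => ?_
    have h1 : ∀ y, f y = c := fun y => by
      have : y ∈ (S : Set (Fin n → ℝ)) := by
        rw [htop]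
        trivial
      rwa [hS] at this
    exact hf ((h1 v).trans ((h1 0).symm.trans (map_zero f)))
  filter_upwards [h] with y hy hyD
  exact hy _ hyD rfl

end generic

namespace LabelledRootedTree

variable {n : ℕ} {t : LabelledRootedTree n} {p y : Fin n → ℝ}

open scoped Classical in
/-- The matrix of the ancestor relation. -/
noncomputable def ancMatrix (t : LabelledRootedTree n) : Matrix (Fin n) (Fin n) ℝ :=
  Matrix.of fun j k => if t.Anc k j then 1 else 0

/-- Ordered by depth, the transpose is block triangular, and its diagonal blocks are identities
because distinct vertices of equal depth are not comparable. -/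
theorem det_ancMatrix (t : LabelledRootedTree n) : t.ancMatrix.det = 1 := by
  classical
  have h : t.ancMatrix.transpose.BlockTriangular fun j => t.graph.dist t.root j := by
    intro i j hij
    simp only [ancMatrix, Matrix.transpose_apply, Matrix.of_apply]
    exact if_neg fun h => absurd h.dist_le (not_le.2 hij)
  rw [← Matrix.det_transpose, h.det]
  refine Finset.prod_eq_one fun d _ => ?_
  suffices h1 : t.ancMatrix.transpose.toSquareBlock (fun j => t.graph.dist t.root j) d = 1 by
    rw [h1, Matrix.det_one]
  ext ⟨i, hi⟩ ⟨j, hj⟩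
  simp only [ancMatrix, Matrix.toSquareBlock_def, Matrix.of_apply, Matrix.transpose_apply,
    Matrix.one_apply, Subtype.mk.injEq]
  refine if_congr ⟨fun h => ?_, ?_⟩ rfl rfl
  · by_contra hne
    have := h.dist_lt hne
    omega
  · rintro rfl
    exact Anc.refl t _

open scoped Classical in
theorem position_eq_add (t : LabelledRootedTree n) (p y : Fin n → ℝ) (j : Fin n) :
    t.position p y j = t.ancMatrix.mulVec y j + ∑ k with t.Anc k j,
      ∑ l with (∃ i, t.IsChild i l ∧ t.IsChild i k) ∧ y l < y k, t.mass p l := by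
  rw [position, Finset.sum_add_distrib, Matrix.mulVec, dotProduct, Finset.sum_filter]
  simp [ancMatrix]

/-- Locally, the positions depend on the service requirements through a translate of a
linear map. -/
theorem Admissible.eventually_position_eq (hy : t.Admissible p y) : ∀ᶠ z in nhds y, ∀ j,
    t.position p z j = t.ancMatrix.mulVec z j + (t.position p y j - t.ancMatrix.mulVec y j) := by
  classical
  have h : ∀ᶠ z in nhds y, ∀ l k, (∃ i, t.IsChild i l ∧ t.IsChild i k) →
      (z l < z k ↔ y l < y k) := by
    simp only [Filter.eventually_all]
    rintro l k ⟨i, hl, hk⟩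
    rcases eq_or_ne l k with rfl | hlk
    · simp
    · have hcl := (continuous_apply (A := fun _ : Fin n => ℝ) l).tendsto y
      have hck := (continuous_apply (A := fun _ : Fin n => ℝ) k).tendsto y
      rcases lt_or_gt_of_ne (hy.ne i l k hl hk hlk) with h | h
      · filter_upwards [hcl.eventually_lt hck h] with z hz
        exact ⟨fun _ => h, fun _ => hz⟩
      · filter_upwards [hck.eventually_lt hcl h] with z hz
        exact ⟨fun h' => absurd h' hz.le.not_gt, fun h' => absurd h' h.le.not_gt⟩
  filter_upwards [h] with z hz j
  rw [position_eq_add, position_eq_add t p y, add_sub_cancel_left]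
  congr 1
  refine Finset.sum_congr rfl fun k _ => Finset.sum_congr ?_ fun _ _ => rfl
  ext l
  simp only [Finset.mem_filter, Finset.mem_univ, true_and]
  exact and_congr_right fun hlk => hz l k hlk

theorem Admissible.hasFDerivAt_jumpTimes (hy : t.Admissible p y) :
    HasFDerivAt (t.jumpTimes p) (LinearMap.toContinuousLinearMap (Matrix.toLin' t.ancMatrix))
      y := by
  set f' := LinearMap.toContinuousLinearMap (Matrix.toLin' t.ancMatrix)
  have hf' : ∀ z j, f' z j = t.ancMatrix.mulVec z j := fun _ _ => rfl
  have h1 : HasFDerivAt (fun z => f' z + (t.jumpTimes p y - f' y)) f' y :=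
    f'.hasFDerivAt.add_const _
  refine h1.congr_of_eventuallyEq ?_
  -- No position is an integer, so all integer parts are constant near `y`, and `Int.fract` only
  -- subtracts a constant.
  have h2 : ∀ᶠ z in nhds y, ∀ j, (⌊t.position p y j⌋ : ℝ) <
      f' z j + (t.position p y j - f' y j) ∧
      f' z j + (t.position p y j - f' y j) < ⌊t.position p y j⌋ + 1 := by
    rw [Filter.eventually_all]
    intro j
    have hc : Filter.Tendsto (fun z => f' z j + (t.position p y j - f' y j)) (nhds y)
        (nhds (f' y j + (t.position p y j - f' y j))) :=
      Continuous.tendsto (by fun_prop) y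
    rw [add_sub_cancel] at hc
    refine hc.eventually (Ioo_mem_nhds ?_ (Int.lt_floor_add_one _))
    refine lt_of_le_of_ne (Int.floor_le _) fun he => hy.fract_ne j ?_
    rw [Int.fract, he, sub_self]
  filter_upwards [hy.eventually_position_eq, h2] with z hz hz'
  funext j
  have h3 : ⌊t.position p z j⌋ = ⌊t.position p y j⌋ := by
    rw [Int.floor_eq_iff, hz j]
    exact ⟨(hz' j).1.le, (hz' j).2⟩
  simp only [jumpTimes, Pi.add_apply, Pi.sub_apply, Int.fract, h3, hf']
  rw [hz j]
  ring

/-- The jump time of the root is `y t.root`. Offsets from it lie in `[0, 1)`, so the positions are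
recovered from their fractional parts; they order the siblings and hence determine every `y j`. -/
theorem injOn_jumpTimes (hp : ∀ i, 0 < p i) (hs : ∑ i, p i = 1) :
    Set.InjOn (t.jumpTimes p) {y | t.Admissible p y} := by
  classical
  intro y hy z hz hyz
  have hroot : y t.root = z t.root := by
    have := congrFun hyz t.root
    rwa [jumpTimes, jumpTimes, position_root, position_root,
      Int.fract_eq_self.2 ⟨hy.root_pos.le, hy.root_lt⟩,
      Int.fract_eq_self.2 ⟨hz.root_pos.le, hz.root_lt⟩] at this
  have hpos : ∀ j, t.position p y j = t.position p z j := by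
    intro j
    have hby := hy.isSchedule hp
    have hbz := hz.isSchedule hp
    have h1 := fract_fract_add_sub (u := y t.root) (hby.nonneg j) (hby.lt_one hp hs j)
    have h2 := fract_fract_add_sub (u := z t.root) (hbz.nonneg j) (hbz.lt_one hp hs j)
    rw [add_sub_cancel] at h1 h2
    have h3 : Int.fract (t.position p y j) = Int.fract (t.position p z j) := congrFun hyz j
    rw [h3, hroot, h2] at h1
    linarith
  funext j
  rcases eq_or_ne j t.root with rfl | hj
  · exact hroot
  · obtain ⟨i, hi⟩ := t.exists_isChild hj
    have h1 := hi.position_eq p y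
    have h2 := hi.position_eq p z
    have h3 : ∑ l with t.IsChild i l ∧ y l < y j, t.mass p l =
        ∑ l with t.IsChild i l ∧ z l < z j, t.mass p l := by
      refine Finset.sum_congr ?_ fun _ _ => rfl
      ext l
      simp only [Finset.mem_filter, Finset.mem_univ, true_and]
      refine and_congr_right fun hl => ?_
      rw [← Admissible.position_lt_iff hp hy hl hi, ← Admissible.position_lt_iff hp hz hl hi,
        hpos, hpos]
    rw [← hpos, ← hpos, ← h3] at h2
    linarith

open scoped Classical in
/-- The range of the service requirement of `j`, for a customer `j` other than the root, is the
service time of the parent of `j`. -/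
noncomputable def parentMass (t : LabelledRootedTree n) (p : Fin n → ℝ) (j : Fin n) : ℝ :=
  if h : j = t.root then 1 else p (t.exists_isChild h).choose

theorem parentMass_root (t : LabelledRootedTree n) (p : Fin n → ℝ) : t.parentMass p t.root = 1 :=
  dif_pos rfl

theorem IsChild.parentMass_eq {i j : Fin n} (h : t.IsChild i j) (p : Fin n → ℝ) :
    t.parentMass p j = p i := by
  rw [parentMass, dif_neg h.ne_root, (t.exists_isChild h.ne_root).choose_spec.unique h]

/-- Beyond the box, admissibility forbids only ties between siblings and integer positions. The
latter force `t.ancMatrix.mulVec y j` into the countable group `massGroup p`, so countably many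
hyperplanes are removed. -/
theorem admissible_ae_eq (t : LabelledRootedTree n) (p : Fin n → ℝ) :
    {y | t.Admissible p y} =ᵐ[volume]
      (Set.univ.pi fun j => Set.Ioo 0 (t.parentMass p j) : Set (Fin n → ℝ)) := by
  refine Filter.eventuallyEq_set.2 ?_
  have h1 : ∀ j k, j ≠ k → ∀ᵐ y : Fin n → ℝ, y j - y k ∉ ({0} : Set ℝ) := by
    intro j k hjk
    have hf : (LinearMap.proj (R := ℝ) (φ := fun _ => ℝ) j -
        LinearMap.proj (R := ℝ) (φ := fun _ => ℝ) k : (Fin n → ℝ) →ₗ[ℝ] ℝ) (Pi.single j 1) ≠ 0 := by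
      simp [hjk.symm]
    exact ae_linearMap_notMem _ hf (Set.countable_singleton 0)
  have h2 : ∀ j, ∀ᵐ y : Fin n → ℝ, t.ancMatrix.mulVec y j ∉ (massGroup p : Set ℝ) := fun j =>
    ae_linearMap_notMem (LinearMap.proj j ∘ₗ Matrix.toLin' t.ancMatrix) (v := Pi.single j 1)
      (by simp [ancMatrix, Anc.refl]) (countable_massGroup p)
  have h1' : ∀ᵐ y : Fin n → ℝ, ∀ j k, j ≠ k → y j - y k ∉ ({0} : Set ℝ) := by
    simpa only [ae_all_iff] using h1
  filter_upwards [h1', ae_all_iff.2 h2] with y hy1 hy2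
  simp only [Set.mem_univ_pi, Set.mem_Ioo]
  constructor
  · intro (hy : t.Admissible p y) j
    rcases eq_or_ne j t.root with rfl | hj
    · rw [parentMass_root]
      exact ⟨hy.root_pos, hy.root_lt⟩
    · obtain ⟨i, hi⟩ := t.exists_isChild hj
      rw [hi.parentMass_eq]
      exact ⟨hy.pos i j hi, hy.lt i j hi⟩
  · intro hy
    have hr := hy t.root
    rw [parentMass_root] at hr
    refine ⟨hr.1, hr.2, fun i j _ => (hy j).1, fun i j hi => ?_, fun i j k _ _ hjk he => ?_,
      fun j hj => ?_⟩
    · rw [← hi.parentMass_eq p]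
      exact (hy j).2
    · exact hy1 j k hjk (by simp [he])
    · apply hy2 j
      have h3 := Int.self_sub_floor (t.position p y j)
      rw [hj, position_eq_add] at h3
      rw [eq_sub_of_add_eq (sub_eq_zero.1 h3)]
      refine sub_mem (intCast_mem_massGroup p _) ?_
      exact Submodule.sum_mem _ fun k _ => Submodule.sum_mem _ fun l _ => mass_mem_massGroup t p l

theorem nullMeasurableSet_jumpTimes_image (hp : ∀ i, 0 < p i) (hs : ∑ i, p i = 1) :
    NullMeasurableSet (t.jumpTimes p '' {y | t.Admissible p y}) := by
  refine nullMeasurable_image_of_fderivWithin _ ?_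
    (fun y hy => (Admissible.hasFDerivAt_jumpTimes hy).hasFDerivWithinAt) (injOn_jumpTimes hp hs)
  refine NullMeasurableSet.congr ?_ (t.admissible_ae_eq p).symm
  exact (MeasurableSet.univ_pi fun _ => measurableSet_Ioo).nullMeasurableSet

theorem volume_jumpTimes_image (hp : ∀ i, 0 < p i) (hs : ∑ i, p i = 1) :
    volume (t.jumpTimes p '' {y | t.Admissible p y}) =
      ENNReal.ofReal (∏ i, p i ^ t.numChildren i) := by
  have hmeas : NullMeasurableSet {y | t.Admissible p y} := by
    refine NullMeasurableSet.congr ?_ (t.admissible_ae_eq p).symm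
    exact (MeasurableSet.univ_pi fun _ => measurableSet_Ioo).nullMeasurableSet
  rw [← lintegral_abs_det_fderiv_eq_addHaar_image₀ _ hmeas
    (fun y hy => (Admissible.hasFDerivAt_jumpTimes hy).hasFDerivWithinAt) (injOn_jumpTimes hp hs)]
  have hdet : (LinearMap.toContinuousLinearMap (Matrix.toLin' t.ancMatrix)).det = 1 := by
    rw [ContinuousLinearMap.det, LinearMap.coe_toContinuousLinearMap, LinearMap.det_toLin',
      det_ancMatrix]
  rw [hdet, abs_one, ENNReal.ofReal_one, setLIntegral_const, one_mul,
    measure_congr (t.admissible_ae_eq p), volume_pi_pi]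
  simp only [Real.volume_Ioo, sub_zero]
  rw [← ENNReal.ofReal_prod_of_nonneg, t.prod_pow_numChildren p (t.parentMass p)
    (t.parentMass_root p) fun i j h => h.parentMass_eq p]
  intro j _
  rcases eq_or_ne j t.root with rfl | hj
  · rw [parentMass_root]
    exact zero_le_one
  · obtain ⟨i, hi⟩ := t.exists_isChild hj
    rw [hi.parentMass_eq]
    exact (hp i).le

end LabelledRootedTree

end PTree

/-! ### Generic jump times come from an admissible tree. -/

namespace PTree

section coverage

variable {n : ℕ} {p : Fin n → ℝ}

open scoped Classical in
/-- A configuration `b` of arrival times whose levels `leftBridge p b (b j)` prior to the arrivals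
are distinct and minimal at `r` is that of a labelled rooted tree with service requirements `y`:
the parent of `j` is the last customer before `j` with a lower level. -/
theorem exists_tree_of_injective {b : Fin n → ℝ} {r : Fin n} {u : ℝ}
    (hbr : ∀ j, j ≠ r → b r < b j) (hb0 : b r = 0) (hbinj : Function.Injective b)
    (hLr : ∀ j, j ≠ r → leftBridge p b (b r) < leftBridge p b (b j))
    (hLinj : Function.Injective fun j => leftBridge p b (b j)) :
    ∃ (t : LabelledRootedTree n) (y : Fin n → ℝ), t.root = r ∧ y r = u ∧
      (∀ i j, t.IsChild i j → 0 < y j ∧ y j < p i) ∧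
      (∀ i j k, t.IsChild i j → t.IsChild i k → j ≠ k → y j ≠ y k) ∧
      ∀ j, t.position p y j = u + b j := by
  set L : Fin n → ℝ := fun j => leftBridge p b (b j) with hL
  have hexists : ∀ j, ∃ i, j ≠ r → b i < b j ∧ L i < L j ∧
      ∀ k, b k < b j → L k < L j → b k ≤ b i := by
    intro j
    rcases eq_or_ne j r with rfl | hj
    · exact ⟨j, fun h => absurd rfl h⟩
    · obtain ⟨i, hi, hmax⟩ := Finset.exists_max_image
        (Finset.univ.filter fun i => b i < b j ∧ L i < L j) b
        ⟨r, by simpa using ⟨hbr j hj, hLr j hj⟩⟩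
      simp only [Finset.mem_filter, Finset.mem_univ, true_and, and_imp] at hi hmax
      exact ⟨i, fun _ => ⟨hi.1, hi.2, hmax⟩⟩
  choose par hpar using hexists
  obtain ⟨t, rfl, ht⟩ := LabelledRootedTree.exists_of_parent fun j hj => (hpar j hj).1
  have hchild : ∀ {i j}, t.IsChild i j → b i < b j ∧ L i < L j ∧
      ∀ k, b k < b j → L k < L j → b k ≤ b i := by
    intro i j h
    obtain ⟨hj, rfl⟩ := (ht i j).1 h
    exact hpar j hj
  -- Just after the parent's arrival the level is `L (par j) + p (par j)`; what is left of the
  -- parent's service when `j` interrupts is `L j - L (par j)`.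
  let y : Fin n → ℝ := fun j => if j = t.root then u else p (par j) - (L j - L (par j))
  have hy : ∀ {i j}, t.IsChild i j → y j = p i - (L j - L i) := by
    intro i j h
    obtain ⟨hj, rfl⟩ := (ht i j).1 h
    simp only [y, if_neg hj]
  have hylt : ∀ {i j k}, t.IsChild i j → t.IsChild i k → (y j < y k ↔ L k < L j) := by
    intro i j k hj hk
    rw [hy hj, hy hk]
    constructor <;> intro h <;> linarith
  have hLsub : ∀ i k, b i < b k → L k - L i =
      p i + ∑ l with b i < b l ∧ b l < b k, p l - (b k - b i) := by
    intro i k hik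
    have h1 : (Finset.univ.filter fun l => b l < b k) = insert i
        ((Finset.univ.filter fun l => b l < b i) ∪
          Finset.univ.filter fun l => b i < b l ∧ b l < b k) := by
      ext l
      simp only [Finset.mem_filter, Finset.mem_univ, true_and, Finset.mem_insert, Finset.mem_union]
      constructor
      · intro h
        rcases lt_trichotomy (b l) (b i) with h' | h' | h'
        · exact Or.inr (Or.inl h')
        · exact Or.inl (hbinj h')
        · exact Or.inr (Or.inr ⟨h', h⟩)
      · rintro (rfl | h | h)
        · exact hik
        · exact h.trans hik
        · exact h.2
    simp only [hL, leftBridge, mul_ite, mul_one, mul_zero, ← Finset.sum_filter]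
    rw [h1, Finset.sum_insert (by simp), Finset.sum_union]
    · ring
    · rw [Finset.disjoint_left]
      intro l hl hl'
      simp only [Finset.mem_filter, Finset.mem_univ, true_and] at hl hl'
      exact lt_asymm hl hl'.1
  refine ⟨t, y, rfl, if_pos rfl, fun i j h => ⟨?_, ?_⟩, fun i j k hj hk hjk he => ?_, fun j => ?_⟩
  · obtain ⟨k, hk, hmin⟩ := Finset.exists_min_image
      (Finset.univ.filter fun k => b i < b k ∧ b k ≤ b j) b
      ⟨j, by simpa using (hchild h).1⟩
    simp only [Finset.mem_filter, Finset.mem_univ, true_and, and_imp] at hk hmin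
    -- Here `k` is the first arrival after `i`. Were its level below that of `j`, it would supersede
    -- `i` as the parent. The drift between `i` and `k` then bounds `y j` below by `b k - b i`.
    have h1 : L j ≤ L k := by
      rcases hk.2.eq_or_lt with h1 | h1
      · rw [hbinj h1]
      · by_contra hn
        exact absurd ((hchild h).2.2 k h1 (not_le.1 hn)) (not_le.2 hk.1)
    have h2 := hLsub i k hk.1
    have h3 : (Finset.univ.filter fun l => b i < b l ∧ b l < b k) = ∅ := by
      refine Finset.filter_eq_empty_iff.2 fun l _ hl => ?_
      exact absurd (hmin l hl.1 (hl.2.le.trans hk.2)) (not_le.2 hl.2)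
    rw [h3, Finset.sum_empty] at h2
    rw [hy h]
    linarith [hk.1]
  · rw [hy h]
    linarith [(hchild h).2.1]
  · rw [hy hj, hy hk] at he
    exact hjk (hLinj (show L j = L k by linarith))
  · refine LabelledRootedTree.induction_on (t := t) (motive := fun j => t.position p y j = u + b j)
      j ?_ ?_
    · rw [t.position_root, hb0, add_zero]
      exact if_pos rfl
    · intro i j h ih
      -- The customers arriving strictly between `i` and its child `j` are those in the subtrees of
      -- the earlier siblings of `j`. Their total mass is the delay of `j` beyond `y j`.
      have hset : (Finset.univ.filter fun l =>
          ∃ k ∈ Finset.univ.filter (fun k => t.IsChild i k ∧ y k < y j), t.Anc k l) =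
          Finset.univ.filter fun l => b i < b l ∧ b l < b j := by
        ext l
        simp only [Finset.mem_filter, Finset.mem_univ, true_and]
        constructor
        · rintro ⟨k, ⟨hk, hkj⟩, hkl⟩
          rw [hylt hk h] at hkj
          -- The level bound makes the induction work: a descendant arriving after `j` would have
          -- found `j` as a later candidate for its parent.
          suffices h1 : (b i < b l ∧ b l < b j) ∧ L j < L l from h1.1
          induction hkl with
          | refl =>
            refine ⟨⟨(hchild hk).1, ?_⟩, hkj⟩
            rcases lt_trichotomy (b k) (b j) with h1 | h1 | h1
            · exact h1
            · rw [hbinj h1] at hkj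
              exact absurd hkj (lt_irrefl _)
            · exact absurd ((hchild hk).2.2 j h1 hkj) (not_le.2 (hchild h).1)
          | @tail l l' _ hl ih' =>
            have h2 : L j < L l' := ih'.2.trans (hchild hl).2.1
            refine ⟨⟨ih'.1.1.trans (hchild hl).1, ?_⟩, h2⟩
            rcases lt_trichotomy (b l') (b j) with h1 | h1 | h1
            · exact h1
            · rw [hbinj h1] at h2
              exact absurd h2 (lt_irrefl _)
            · exact absurd ((hchild hl).2.2 j h1 h2) (not_le.2 ih'.1.2)
        · refine LabelledRootedTree.induction_on (t := t) (motive := fun l =>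
            b i < b l ∧ b l < b j → ∃ k, (t.IsChild i k ∧ y k < y j) ∧ t.Anc k l) l ?_ ?_
          · rintro ⟨h1, -⟩
            rcases eq_or_ne i t.root with rfl | hi
            · exact absurd h1 (lt_irrefl _)
            · exact absurd h1 (lt_asymm (hbr i hi))
          · rintro l l' hl ih' ⟨h1, h2⟩
            have h3 : L j < L l' := by
              rcases lt_trichotomy (L j) (L l') with h3 | h3 | h3
              · exact h3
              · rw [hLinj h3] at h2
                exact absurd h2 (lt_irrefl _)
              · exact absurd ((hchild h).2.2 l' h2 h3) (not_le.2 h1)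
            rcases ((hchild hl).2.2 i h1 ((hchild h).2.1.trans h3)).eq_or_lt with h4 | h4
            · obtain rfl := hbinj h4
              exact ⟨l', ⟨hl, (hylt hl h).2 h3⟩, LabelledRootedTree.Anc.refl t _⟩
            · obtain ⟨k, hk, hkl⟩ := ih' ⟨h4, (hchild hl).1.trans h2⟩
              exact ⟨k, hk, hkl.trans hl.anc⟩
      rw [h.position_eq, ih, LabelledRootedTree.sum_mass_eq p _ (i := i)
        fun k hk => (Finset.mem_filter.1 hk).2.1, hset, hy h, hLsub i j (hchild h).1]
      ring

/-- Every generic configuration of jump times is that of an admissible tree. -/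
theorem exists_admissible_jumpTimes_eq [Nonempty (Fin n)]
    (hs : ∑ i, p i = 1) {χ : Fin n → ℝ} (h0 : ∀ j, 0 < χ j) (h1 : ∀ j, χ j < 1)
    (hχ : ∀ j k, j ≠ k → χ j - χ k ∉ massGroup p) :
    ∃ (t : LabelledRootedTree n) (y : Fin n → ℝ), t.Admissible p y ∧ t.jumpTimes p y = χ := by
  obtain ⟨r, -, hr⟩ := Finset.exists_min_image Finset.univ
    (fun j => leftBridge p χ (χ j)) Finset.univ_nonempty
  set b : Fin n → ℝ := fun j => Int.fract (χ j - χ r) with hb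
  have hb0 : ∀ j, 0 ≤ b j := fun j => Int.fract_nonneg _
  have hb1 : ∀ j, b j < 1 := fun j => Int.fract_lt_one _
  have hχb : ∀ j, Int.fract (χ r + b j) = χ j := fun j => fract_add_fract_sub (h0 j).le (h1 j)
  have hbr : b r = 0 := by simp [hb]
  have hgroup : ∀ j k, b j - b k ∈ massGroup p → j = k := by
    intro j k h
    by_contra hjk
    apply hχ j k hjk
    have h2 : χ j - χ k = (b j - b k) + ((⌊χ j - χ r⌋ - ⌊χ k - χ r⌋ : ℤ) : ℝ) := by
      simp only [hb, Int.fract]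
      push_cast
      ring
    rw [h2]
    exact add_mem h (intCast_mem_massGroup p _)
  have hbinj : Function.Injective b := fun j k h => hgroup j k (by
    rw [h, sub_self]
    exact zero_mem _)
  have hLinj : Function.Injective fun j => leftBridge p b (b j) := by
    intro j k h
    apply hgroup
    simp only [leftBridge] at h
    -- Equal levels would make a difference of arrival times an integer combination of the masses.
    have h2 : b j - b k = ∑ i, p i * (if b i < b j then 1 else 0) -
        ∑ i, p i * (if b i < b k then 1 else 0) := by
      linarith
    rw [h2]
    exact sub_mem (sum_mul_ite_mem_massGroup p _) (sum_mul_ite_mem_massGroup p _)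
  have hLmin : ∀ j, leftBridge p b (b r) ≤ leftBridge p b (b j) := by
    intro j
    have h2 := hr j (Finset.mem_univ j)
    have h3 := fun j => leftBridge_fract hs hb0 hb1 (h0 r).le (h1 r) (hb0 j) (hb1 j)
    simp only [hχb] at h3
    have h4 := h3 j
    have h5 := h3 r
    linarith
  obtain ⟨t, y, rfl, hyr, hy, hne, hpos⟩ := exists_tree_of_injective (u := χ r)
    (fun j hj => lt_of_le_of_ne (hbr.trans_le (hb0 j)) fun h => hj (hbinj h).symm) hbr hbinj
    (fun j hj => lt_of_le_of_ne (hLmin j) fun h => hj (hLinj h).symm) hLinj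
  have hjump : ∀ j, t.jumpTimes p y j = χ j := fun j => by
    rw [LabelledRootedTree.jumpTimes, hpos, hχb]
  refine ⟨t, y, ⟨?_, ?_, fun i j h => (hy i j h).1, fun i j h => (hy i j h).2, hne, fun j => ?_⟩,
    funext hjump⟩
  · rw [hyr]
    exact h0 _
  · rw [hyr]
    exact h1 _
  · exact (hjump j).trans_ne (h0 j).ne'

end coverage

end PTree

/-! ### The law of the tree. -/

namespace PTree

section law

variable {n : ℕ} {p : Fin n → ℝ}

theorem ae_exists_admissible (hs : ∑ i, p i = 1) :
    ∀ᵐ x : Fin n → ℝ ∂volume.restrict (Set.univ.pi fun _ => Set.Icc (0 : ℝ) 1),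
      ∃ (t : LabelledRootedTree n) (y : Fin n → ℝ), t.Admissible p y ∧ t.jumpTimes p y = x := by
  have : Nonempty (Fin n) := by
    by_contra h
    rw [not_nonempty_iff] at h
    simp at hs
  have h1 : ∀ᵐ x : Fin n → ℝ, ∀ j k, j ≠ k → x j - x k ∉ (massGroup p : Set ℝ) := by
    simp only [ae_all_iff]
    intro j k hjk
    have hf : (LinearMap.proj (R := ℝ) (φ := fun _ => ℝ) j -
        LinearMap.proj (R := ℝ) (φ := fun _ => ℝ) k :
        (Fin n → ℝ) →ₗ[ℝ] ℝ) (Pi.single j 1) ≠ 0 := by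
      simp [hjk.symm]
    exact ae_linearMap_notMem _ hf (countable_massGroup p)
  have h2 : ∀ᵐ x : Fin n → ℝ, ∀ j, x j ∉ ({0, 1} : Set ℝ) := by
    rw [ae_all_iff]
    intro j
    have hf : (LinearMap.proj (R := ℝ) (φ := fun _ => ℝ) j : (Fin n → ℝ) →ₗ[ℝ] ℝ)
        (Pi.single j 1) ≠ 0 := by
      simp
    exact ae_linearMap_notMem _ hf (Set.toFinite _).countable
  filter_upwards [ae_restrict_of_ae h1, ae_restrict_of_ae h2,
    ae_restrict_mem (MeasurableSet.univ_pi fun _ => measurableSet_Icc)] with x hx1 hx2 hx3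
  rw [Set.mem_univ_pi] at hx3
  refine exists_admissible_jumpTimes_eq hs (fun j => ?_) (fun j => ?_) hx1
  · exact lt_of_le_of_ne (hx3 j).1 fun h => hx2 j (Or.inl h.symm)
  · exact lt_of_le_of_ne (hx3 j).2 fun h => hx2 j (Or.inr h)

theorem pTreeLaw_singleton (p : Fin n → ℝ) (t : LabelledRootedTree n) :
    pTreeLaw p {t} = ENNReal.ofReal (∏ i, p i ^ t.numChildren i) := by
  rw [pTreeLaw, Measure.sum_apply _ MeasurableSpace.measurableSet_top, tsum_eq_single t]
  · simp
  · intro t' ht'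
    simp [ht']

theorem hasLaw_lifoTree (hp : ∀ i, 0 < p i) (hs : ∑ i, p i = 1) :
    HasLaw (fun x : Fin n → ℝ => lifoTree (vervaat (bridge p x)) (arrival p x))
      ((pTreeLaw p).map some)
      (volume.restrict (Set.univ.pi fun _ => Set.Icc (0 : ℝ) 1)) := by
  set μ : Measure (Fin n → ℝ) := volume.restrict (Set.univ.pi fun _ => Set.Icc (0 : ℝ) 1)
  set F : (Fin n → ℝ) → Option (LabelledRootedTree n) :=
    fun x => lifoTree (vervaat (bridge p x)) (arrival p x)
  let E : LabelledRootedTree n → Set (Fin n → ℝ) :=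
    fun t => t.jumpTimes p '' {y | t.Admissible p y}
  have hF : ∀ t, ∀ x ∈ E t, F x = some t := by
    rintro t _ ⟨y, hy, rfl⟩
    exact LabelledRootedTree.Admissible.lifoTree_eq hp hs hy
  have hE : ∀ᵐ x ∂μ, ∃ t, x ∈ E t := by
    filter_upwards [ae_exists_admissible hs] with x ⟨t, y, hy, hyx⟩
    exact ⟨t, y, hy, hyx⟩
  have hEnull : ∀ t, NullMeasurableSet (E t) μ := fun t =>
    (LabelledRootedTree.nullMeasurableSet_jumpTimes_image hp hs).mono_ac
      Measure.restrict_le_self.absolutelyContinuous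
  have hEμ : ∀ t, μ (E t) = ENNReal.ofReal (∏ i, p i ^ t.numChildren i) := by
    intro t
    rw [Measure.restrict_eq_self, LabelledRootedTree.volume_jumpTimes_image hp hs]
    rintro _ ⟨y, hy, rfl⟩
    rw [Set.mem_univ_pi]
    exact fun j => ⟨Int.fract_nonneg _, (Int.fract_lt_one _).le⟩
  -- On each null-measurable set `E t` the tree is constant, and these finitely many sets carry `μ`.
  have hmeas : AEMeasurable F μ := by
    have hμ : μ.restrict (⋃ t, E t) = μ := by
      refine Measure.restrict_eq_self_of_ae_mem ?_
      filter_upwards [hE] with x hx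
      exact Set.mem_iUnion.2 hx
    rw [← hμ, aemeasurable_iUnion_iff]
    intro t
    refine (aemeasurable_const (b := some t)).congr ?_
    filter_upwards [ae_restrict_mem₀ (hEnull t)] with x hx
    exact (hF t x hx).symm
  refine ⟨hmeas, ?_⟩
  have hsome : Measurable (some : LabelledRootedTree n → Option (LabelledRootedTree n)) :=
    fun _ _ => trivial
  have : MeasurableSingletonClass (Option (LabelledRootedTree n)) := ⟨fun _ => trivial⟩
  refine Measure.ext_of_singleton fun o => ?_
  rw [Measure.map_apply_of_aemeasurable hmeas trivial, Measure.map_apply hsome trivial]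
  cases o with
  | none =>
    have h1 : (some ⁻¹' {none} : Set (LabelledRootedTree n)) = ∅ := by
      ext t
      simp
    rw [h1, measure_empty]
    refine measure_eq_zero_iff_ae_notMem.2 ?_
    filter_upwards [hE] with x ⟨t, hx⟩ hx'
    rw [Set.mem_preimage, hF t x hx] at hx'
    exact absurd hx' (by simp)
  | some t =>
    have h1 : (some ⁻¹' {some t} : Set (LabelledRootedTree n)) = {t} := by
      ext t'
      simp
    rw [h1, pTreeLaw_singleton, ← hEμ]
    refine measure_congr (Filter.eventuallyEq_set.2 ?_)
    filter_upwards [hE] with x ⟨t', hx⟩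
    refine ⟨fun hx' => ?_, fun hx' => hF t x hx'⟩
    rw [Set.mem_preimage, hF t' x hx, Set.mem_singleton_iff, Option.some_inj] at hx'
    rwa [← hx']

end law

end PTree

theorem mainTheorem9 {Ω : Type*} [MeasurableSpace Ω] (P : Measure Ω) [IsProbabilityMeasure P]
    (n : ℕ) (p : Fin n → ℝ) (hp_pos : ∀ i, 0 < p i) (hp_anti : Antitone p)
    (hp_sum : ∑ i, p i = 1)
    (χ : Fin n → Ω → ℝ) (hχ_indep : iIndepFun χ P)
    (hχ_unif : ∀ i, HasLaw (χ i) (volume.restrict (Set.Icc (0 : ℝ) 1)) P) :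
    (∀ᵐ ω ∂P, ∀ i,
      volume {t : ℝ | t ∈ Set.Icc (0 : ℝ) 1 ∧ PTree.InService
        (PTree.vervaat (PTree.bridge p (fun k => χ k ω)))
        (PTree.arrival p (fun k => χ k ω)) i t} = ENNReal.ofReal (p i)) ∧
    HasLaw
      (fun ω => PTree.lifoTree
        (PTree.vervaat (PTree.bridge p (fun k => χ k ω)))
        (PTree.arrival p (fun k => χ k ω)))
      ((PTree.pTreeLaw p).map some) P := by
  -- By independence the jump times are jointly uniform on the cube, so both claims reduce to
  -- Lebesgue measure there.
  have hχ : HasLaw (fun ω k => χ k ω)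
      (volume.restrict (Set.univ.pi fun _ : Fin n => Set.Icc (0 : ℝ) 1)) P := by
    refine ⟨aemeasurable_pi_lambda _ fun i => (hχ_unif i).aemeasurable, ?_⟩
    rw [(iIndepFun_iff_map_fun_eq_pi_map fun i => (hχ_unif i).aemeasurable).1 hχ_indep,
      volume_pi, Measure.restrict_pi_pi]
    exact congrArg Measure.pi (funext fun i => (hχ_unif i).map_eq)
  constructor
  · have h := PTree.ae_exists_admissible hp_sum
    rw [← hχ.map_eq] at h
    filter_upwards [ae_of_ae_map hχ.aemeasurable h] with ω ⟨t, y, hy, hyω⟩ i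
    rw [← hyω]
    exact hy.volume_inService hp_pos hp_sum i
  · exact (PTree.hasLaw_lifoTree hp_pos hp_sum).comp hχ
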